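/- For $n \ge 0$ let $[n]=\{1,\dots,n\}$. A permutation of $[n]$ is \emph{separable} if it can be obtained from the permutation of one element by successively applying direct sums $\sigma\oplus\tau$ and skew sums $\sigma\ominus\tau$ (equivalently, it belongs to the closure of $\{12,21\}$ under substitution). The \emph{adjacency matrix} of a permutation $\sigma$ of $[n]$ is the $n\times n$ $0,1$-matrix $M_\sigma$ with a $1$ in position $(x,y)$ if and only if $\sigma(x)<\sigma(y)$. A matrix is \emph{mixed} if it has a non-constant row and a non-constant column. A \emph{$k$-almost mixed minor} of a matrix $M$ consists of a partition of its rows into $k$ non-empty intervals $R_1<\dots<R_k$ and a partition of its columns into $k$ non-empty intervals $C_1<\dots<C_k$ such that for all $i\neq j$ the cell $R_i\cap C_j$ (the submatrix of $M$ with rows $R_i$ and columns $C_j$) is mixed. The permutation $\sigma$ is \emph{$k$-almost mixed free} if $M_\sigma$ has no $k$-almost mixed minor. \textbf{Corollary.} For every integer $k\ge 1$ and every $n \ge 0$, every $k$-almost mixed free permutation of $[n]$ is a product (composition) of at most $4\cdot 3^k$ separable permutations of $[n]$ (the empty product being the identity). -/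

import Mathlib

namespace PermFactor

/-- A partition of the linearly ordered set `Fin n` into `k` nonempty intervals, enumerated in
increasing order. (Disjointness and convexity of the parts follow from `lt_of_lt`
and `exists_mem`, see `IntervalPartition.disjoint` and `IntervalPartition.ordConnected`.) -/
structure IntervalPartition (n k : ℕ) where
  part : Fin k → Finset (Fin n)
  nonempty : ∀ i, (part i).Nonempty
  exists_mem : ∀ x, ∃ i, x ∈ part i
  lt_of_lt : ∀ i j, i < j → ∀ x ∈ part i, ∀ y ∈ part j, x < y

theorem IntervalPartition.disjoint {n k : ℕ} (P : IntervalPartition n k) {i j : Fin k}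
    (h : i ≠ j) : Disjoint (P.part i) (P.part j) := by
  rw [Finset.disjoint_left]
  intro x hi hj
  rcases lt_or_gt_of_ne h with h | h
  · exact lt_irrefl _ (P.lt_of_lt _ _ h x hi x hj)
  · exact lt_irrefl _ (P.lt_of_lt _ _ h x hj x hi)

theorem IntervalPartition.ordConnected {n k : ℕ} (P : IntervalPartition n k) (i : Fin k) :
    (P.part i : Set (Fin n)).OrdConnected := by
  refine ⟨fun x hx y hy z hz => ?_⟩
  obtain ⟨j, hj⟩ := P.exists_mem z
  rcases lt_trichotomy j i with h | h | h
  · exact absurd (P.lt_of_lt _ _ h z hj x hx) (not_lt.mpr hz.1)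
  · subst h; exact hj
  · exact absurd (P.lt_of_lt _ _ h y hy z hj) (not_lt.mpr hz.2)

section Matrices

variable {p q : ℕ} {α : Type*}

/-- The submatrix of `M` with rows `R` and columns `C` has only constant rows. -/
def IsHorizontal (M : Matrix (Fin p) (Fin q) α) (R : Finset (Fin p)) (C : Finset (Fin q)) :
    Prop :=
  ∀ r ∈ R, ∀ c ∈ C, ∀ c' ∈ C, M r c = M r c'

/-- The submatrix of `M` with rows `R` and columns `C` has only constant columns. -/
def IsVertical (M : Matrix (Fin p) (Fin q) α) (R : Finset (Fin p)) (C : Finset (Fin q)) :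
    Prop :=
  ∀ c ∈ C, ∀ r ∈ R, ∀ r' ∈ R, M r c = M r' c

/-- The submatrix of `M` with rows `R` and columns `C` is mixed: neither horizontal nor
vertical. -/
def IsMixed (M : Matrix (Fin p) (Fin q) α) (R : Finset (Fin p)) (C : Finset (Fin q)) : Prop :=
  ¬ IsHorizontal M R C ∧ ¬ IsVertical M R C

/-- A `k`-almost mixed minor of `M`: a division of `M` into `k` row intervals and `k` column
intervals such that every cell off the diagonal is mixed. -/
def IsAlmostMixedMinor {k : ℕ} (M : Matrix (Fin p) (Fin q) α)
    (R : IntervalPartition p k) (C : IntervalPartition q k) : Prop :=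
  ∀ i j : Fin k, i ≠ j → IsMixed M (R.part i) (C.part j)

/-- `M` has no `k`-almost mixed minor. -/
def MatrixAlmostMixedFree (k : ℕ) (M : Matrix (Fin p) (Fin q) α) : Prop :=
  ¬ ∃ (R : IntervalPartition p k) (C : IntervalPartition q k), IsAlmostMixedMinor M R C

end Matrices

/-- The adjacency matrix of a permutation: the 0,1-matrix with a `1` in position `(x, y)` if and
only if `σ x < σ y`. -/
def adjMatrix {n : ℕ} (σ : Equiv.Perm (Fin n)) : Matrix (Fin n) (Fin n) ℕ :=
  fun x y => if σ x < σ y then 1 else 0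

/-- A permutation is `k`-almost mixed free if its adjacency matrix is. -/
def AlmostMixedFree (k : ℕ) {n : ℕ} (σ : Equiv.Perm (Fin n)) : Prop :=
  MatrixAlmostMixedFree k (adjMatrix σ)

/-- The direct sum `σ ⊕ τ`: the first `m` positions carry `σ` with the values `0, …, m - 1`, and
the last `n` positions carry `τ` with the values `m, …, m + n - 1`. -/
def directSum {m n : ℕ} (σ : Equiv.Perm (Fin m)) (τ : Equiv.Perm (Fin n)) :
    Equiv.Perm (Fin (m + n)) :=
  finSumFinEquiv.symm.trans ((Equiv.sumCongr σ τ).trans finSumFinEquiv)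

/-- The skew sum `σ ⊖ τ`: the first `m` positions carry `σ` with the values `n, …, n + m - 1`, and
the last `n` positions carry `τ` with the values `0, …, n - 1`. -/
def skewSum {m n : ℕ} (σ : Equiv.Perm (Fin m)) (τ : Equiv.Perm (Fin n)) :
    Equiv.Perm (Fin (m + n)) :=
  finSumFinEquiv.symm.trans ((Equiv.sumCongr σ τ).trans
    ((Equiv.sumComm (Fin m) (Fin n)).trans
      (finSumFinEquiv.trans (finCongr (Nat.add_comm n m)))))

/-- Separable permutations: those obtained from the permutation of one element by successively
applying direct sums and skew sums (equivalently, the closure of `{12, 21}` under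
substitution). -/
inductive IsSeparable : {n : ℕ} → Equiv.Perm (Fin n) → Prop
  | one : IsSeparable (1 : Equiv.Perm (Fin 1))
  | directSum {m n : ℕ} {σ : Equiv.Perm (Fin m)} {τ : Equiv.Perm (Fin n)} :
      IsSeparable σ → IsSeparable τ → IsSeparable (directSum σ τ)
  | skewSum {m n : ℕ} {σ : Equiv.Perm (Fin m)} {τ : Equiv.Perm (Fin n)} :
      IsSeparable σ → IsSeparable τ → IsSeparable (skewSum σ τ)

end PermFactor

/-! Factoring a permutation into separable ones amounts to sorting its list of values by separable
rearrangements. These can be substituted into one another, so moving blocks and rearranging their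
contents happen in parallel, and costs at nested levels combine by maximum instead of adding up.

Crossing of two position intervals makes the corresponding off-diagonal cells mixed, so the
hypothesis bounds families of pairwise crossing intervals (`crossFree_of_almostMixedFree`). Sorting
goes by induction on that bound (`srt_of_crossFree`).

The merging tool is `srt_of_cliqueLE`: peeling off a maximal chain of disjoint hulls and reinserting
it costs two steps and lowers the overlap by one. Blocks lying in single gaps of a monotone function
overlap at most `2 * k + 1` times (`IsBlocks.cliqueLE`).

Suppose neighbours in a list are separated by values of a list `Z` on one side. The values inside
the hull of `Z` have a smaller crossing bound, because `Z` could join any crossing family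
(`crossFree_of_gap`). The values below or above `Z` oscillate boundedly and are sorted along a
Cartesian tree (`srt_of_levelFree`). Together this sorts every list separated by its context
(`srt_of_context`).

A general list is split recursively into parts, each cut by its context. The depth is unbounded, but
all levels are rearranged simultaneously: `exists_presorting` produces increasing blocks that each
need only `4 * k` more steps. The total is quadratic in `k`, well below the exponential bound. -/

namespace PermFactor

/-! ### Sorting by separable rearrangements -/

/-- `SepRel l l'`: the list `l'` is a rearrangement of `l` by a separable permutation (or both
lists are empty). -/
inductive SepRel {α : Type*} : List α → List α → Prop
  | nil : SepRel [] []
  | single (a : α) : SepRel [a] [a]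
  | sum {a a' b b' : List α} : SepRel a a' → SepRel b b' → SepRel (a ++ b) (a' ++ b')
  | skew {a a' b b' : List α} : SepRel a a' → SepRel b b' → SepRel (a ++ b) (b' ++ a')

namespace SepRel

variable {α β : Type*}

theorem refl (l : List α) : SepRel l l := by
  induction l with
  | nil => exact .nil
  | cons a l ih => exact (SepRel.single a).sum ih

theorem symm {l l' : List α} (h : SepRel l l') : SepRel l' l := by
  induction h with
  | nil => exact .nil
  | single a => exact .single a
  | sum _ _ h₁ h₂ => exact h₁.sum h₂
  | skew _ _ h₁ h₂ => exact h₂.skew h₁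

theorem perm {l l' : List α} (h : SepRel l l') : l.Perm l' := by
  induction h with
  | nil => exact .nil
  | single a => exact .refl _
  | sum _ _ h₁ h₂ => exact h₁.append h₂
  | skew _ _ h₁ h₂ => exact (h₁.append h₂).trans List.perm_append_comm

theorem reverse {l l' : List α} (h : SepRel l l') : SepRel l.reverse l'.reverse := by
  induction h with
  | nil => exact .nil
  | single a => exact .single a
  | sum _ _ h₁ h₂ => simpa using h₂.sum h₁
  | skew _ _ h₁ h₂ => simpa using h₂.skew h₁

theorem self_reverse (l : List α) : SepRel l l.reverse := by
  induction l with
  | nil => exact .nil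
  | cons a l ih => simpa using (SepRel.single a).skew ih

/-- Closure under substitution, the source of all parallelism below. -/
theorem flatMap {l l' : List β} (h : SepRel l l') {F F' : β → List α}
    (hF : ∀ b ∈ l, SepRel (F b) (F' b)) : SepRel (l.flatMap F) (l'.flatMap F') := by
  induction h with
  | nil => exact .nil
  | single a => simpa using hF a (by simp)
  | sum _ _ h₁ h₂ =>
    simp only [List.flatMap_append]
    exact (h₁ fun b hb => hF b (by simp [hb])).sum (h₂ fun b hb => hF b (by simp [hb]))
  | skew _ _ h₁ h₂ =>
    simp only [List.flatMap_append]
    exact (h₁ fun b hb => hF b (by simp [hb])).skew (h₂ fun b hb => hF b (by simp [hb]))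

/-- Used to move whole blocks while only their representatives, such as minima, are being sorted. -/
theorem lift_map {f : β → α} {t t' : List α} (h : SepRel t t') :
    ∀ l : List β, l.map f = t → ∃ l', SepRel l l' ∧ l'.map f = t' := by
  induction h with
  | nil => intro l hl; exact ⟨l, .refl l, hl⟩
  | single a => intro l hl; exact ⟨l, .refl l, hl⟩
  | sum _ _ h₁ h₂ =>
    intro l hl
    obtain ⟨l₁, l₂, rfl, e₁, e₂⟩ := List.map_eq_append_iff.1 hl
    obtain ⟨m₁, s₁, r₁⟩ := h₁ l₁ e₁
    obtain ⟨m₂, s₂, r₂⟩ := h₂ l₂ e₂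
    exact ⟨_, s₁.sum s₂, by simp [r₁, r₂]⟩
  | skew _ _ h₁ h₂ =>
    intro l hl
    obtain ⟨l₁, l₂, rfl, e₁, e₂⟩ := List.map_eq_append_iff.1 hl
    obtain ⟨m₁, s₁, r₁⟩ := h₁ l₁ e₁
    obtain ⟨m₂, s₂, r₂⟩ := h₂ l₂ e₂
    exact ⟨_, s₁.skew s₂, by simp [r₁, r₂]⟩

/-- Peel off the head: a sum keeps it in front, a skew sum sends it to the end. Hence the rejected
elements come out reversed. -/
theorem filter (p : α → Bool) (l : List α) :
    SepRel l (l.filter p ++ (l.filter fun a => !p a).reverse) := by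
  induction l with
  | nil => exact .nil
  | cons a l ih =>
    cases h : p a
    · simpa [h] using (SepRel.single a).skew ih
    · simpa [h] using (SepRel.single a).sum ih

end SepRel

/-- `Steps m l l'`: the list `l'` arises from `l` by `m` successive separable rearrangements. -/
def Steps {α : Type*} : ℕ → List α → List α → Prop
  | 0, l, l' => l = l'
  | m + 1, l, l' => ∃ l₁, SepRel l l₁ ∧ Steps m l₁ l'

namespace Steps

variable {α β : Type*}

theorem refl (m : ℕ) (l : List α) : Steps m l l := by
  induction m with
  | zero => rfl
  | succ m ih => exact ⟨l, .refl l, ih⟩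

theorem of_sepRel {l l' : List α} (h : SepRel l l') : Steps 1 l l' := ⟨l', h, rfl⟩

theorem trans {m n : ℕ} {l l' l'' : List α} (h : Steps m l l') (h' : Steps n l' l'') :
    Steps (m + n) l l'' := by
  induction m generalizing l with
  | zero => cases h; simpa using h'
  | succ m ih =>
    obtain ⟨l₁, h₁, h₂⟩ := h
    rw [Nat.add_right_comm]
    exact ⟨l₁, h₁, ih h₂⟩

theorem mono {m n : ℕ} (hmn : m ≤ n) {l l' : List α} (h : Steps m l l') : Steps n l l' := by
  obtain ⟨d, rfl⟩ := Nat.exists_eq_add_of_le hmn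
  exact h.trans (refl d l')

theorem perm {m : ℕ} {l l' : List α} (h : Steps m l l') : l.Perm l' := by
  induction m generalizing l with
  | zero => cases h; exact .refl _
  | succ m ih =>
    obtain ⟨l₁, h₁, h₂⟩ := h
    exact h₁.perm.trans (ih h₂)

theorem reverse {m : ℕ} {l l' : List α} (h : Steps m l l') : Steps m l.reverse l'.reverse := by
  induction m generalizing l with
  | zero => cases h; rfl
  | succ m ih =>
    obtain ⟨l₁, h₁, h₂⟩ := h
    exact ⟨_, h₁.reverse, ih h₂⟩

/-- Outer and inner rearrangements advance together, so the cost is `m` and not `2 * m`. -/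
theorem flatMap {m : ℕ} {l l' : List β} (h : Steps m l l') {F F' : β → List α}
    (hF : ∀ b ∈ l, Steps m (F b) (F' b)) : Steps m (l.flatMap F) (l'.flatMap F') := by
  induction m generalizing l F with
  | zero =>
    cases h
    exact List.flatMap_congr hF
  | succ m ih =>
    obtain ⟨l₁, h₁, h₂⟩ := h
    have : ∀ b, ∃ G, b ∈ l → SepRel (F b) G ∧ Steps m G (F' b) := by
      intro b
      by_cases hb : b ∈ l
      · obtain ⟨G, hG⟩ := hF b hb
        exact ⟨G, fun _ => hG⟩
      · exact ⟨[], fun h => absurd h hb⟩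
    choose G hG using this
    exact ⟨_, h₁.flatMap fun b hb => (hG b hb).1,
      ih h₂ fun b hb => (hG b (h₁.perm.mem_iff.2 hb)).2⟩

theorem flatMap_right {m : ℕ} (l : List β) {F F' : β → List α}
    (hF : ∀ b ∈ l, Steps m (F b) (F' b)) : Steps m (l.flatMap F) (l.flatMap F') :=
  (refl m l).flatMap hF

theorem map {m : ℕ} {l l' : List β} (h : Steps m l l') (f : β → α) :
    Steps m (l.map f) (l'.map f) := by
  have := h.flatMap (F := fun b => [f b]) (F' := fun b => [f b]) fun b _ => refl m _
  simpa [List.map_eq_flatMap] using this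

theorem append {m : ℕ} {a a' b b' : List α} (h : Steps m a a') (h' : Steps m b b') :
    Steps m (a ++ b) (a' ++ b') := by
  have := flatMap_right (m := m) [true, false] (F := fun i => cond i a b)
    (F' := fun i => cond i a' b') (by simp [h, h'])
  simpa using this

theorem lift_map {m : ℕ} {f : β → α} {l : List β} {t : List α} (h : Steps m (l.map f) t) :
    ∃ l', Steps m l l' ∧ l'.map f = t := by
  induction m generalizing l with
  | zero => exact ⟨l, rfl, h⟩
  | succ m ih =>
    obtain ⟨t₁, h₁, h₂⟩ := h
    obtain ⟨l₁, s₁, rfl⟩ := h₁.lift_map l rfl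
    obtain ⟨l', s', e⟩ := ih h₂
    exact ⟨l', ⟨l₁, s₁, s'⟩, e⟩

/-- The second step undoes the reversal caused by `SepRel.filter`. -/
theorem separate (p : α → Bool) (l : List α) :
    Steps 2 l (l.filter p ++ l.filter fun a => !p a) := by
  have h := (SepRel.refl (l.filter p)).sum
    (SepRel.self_reverse (l.filter fun a => !p a).reverse)
  rw [List.reverse_reverse] at h
  exact (of_sepRel (SepRel.filter p l)).trans (of_sepRel h)

end Steps

/-- The list can be sorted increasingly by `m` separable rearrangements. -/
def Srt (m : ℕ) (l : List ℕ) : Prop := ∃ l', Steps m l l' ∧ l'.Pairwise (· < ·)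

namespace Srt

theorem mono {m n : ℕ} (hmn : m ≤ n) {l : List ℕ} (h : Srt m l) : Srt n l := by
  obtain ⟨l', h, hs⟩ := h
  exact ⟨l', h.mono hmn, hs⟩

theorem of_pairwise {l : List ℕ} (m : ℕ) (h : l.Pairwise (· < ·)) : Srt m l :=
  ⟨l, .refl m l, h⟩

theorem of_length_le_one {l : List ℕ} (m : ℕ) (h : l.length ≤ 1) : Srt m l := by
  refine of_pairwise m ?_
  match l, h with
  | [], _ => exact .nil
  | [a], _ => simp

theorem of_steps {m n : ℕ} {l l' : List ℕ} (h : Steps m l l') (h' : Srt n l') :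
    Srt (m + n) l := by
  obtain ⟨l'', h'', hs⟩ := h'
  exact ⟨l'', h.trans h'', hs⟩

theorem append {m : ℕ} {a b : List ℕ} (ha : Srt m a) (hb : Srt m b)
    (hab : ∀ x ∈ a, ∀ y ∈ b, x < y) : Srt m (a ++ b) := by
  obtain ⟨a', ha, sa⟩ := ha
  obtain ⟨b', hb, sb⟩ := hb
  refine ⟨_, ha.append hb, List.pairwise_append.2 ⟨sa, sb, fun x hx y hy => ?_⟩⟩
  exact hab x (ha.perm.mem_iff.2 hx) y (hb.perm.mem_iff.2 hy)

end Srt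

/-- Sorting a concatenation of increasing blocks block by block. -/
theorem Srt.flatten {m : ℕ} {Bs : List (List ℕ)} (hB : ∀ B ∈ Bs, Srt m B)
    (hs : Bs.Pairwise fun B C => ∀ x ∈ B, ∀ y ∈ C, x < y) : Srt m Bs.flatten := by
  induction Bs with
  | nil => exact of_pairwise m .nil
  | cons B Bs ih =>
    rw [List.pairwise_cons] at hs
    refine (hB B (by simp)).append (ih (fun C hC => hB C (by simp [hC])) hs.2) ?_
    intro x hx y hy
    obtain ⟨C, hC, hy⟩ := List.mem_flatten.1 hy
    exact hs.1 C hC x hx y hy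

/-! ### Merging increasing blocks with boundedly overlapping hulls -/

/-- The minimum of a nonempty list. -/
noncomputable def lmin (l : List ℕ) : ℕ := sInf {a | a ∈ l}

/-- The maximum of a nonempty list. -/
noncomputable def lmax (l : List ℕ) : ℕ := l.toFinset.sup id

theorem lmin_mem {l : List ℕ} (h : l ≠ []) : lmin l ∈ l :=
  Nat.sInf_mem (s := {a | a ∈ l}) (List.exists_mem_of_ne_nil l h)

theorem lmin_le {l : List ℕ} {a : ℕ} (h : a ∈ l) : lmin l ≤ a := Nat.sInf_le h

theorem lmax_mem {l : List ℕ} (h : l ≠ []) : lmax l ∈ l := by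
  obtain ⟨a, ha, e⟩ := Finset.exists_mem_eq_sup l.toFinset
    (by simpa [Finset.nonempty_iff_ne_empty] using h) id
  rw [lmax, e]
  simpa using ha

theorem le_lmax {l : List ℕ} {a : ℕ} (h : a ∈ l) : a ≤ lmax l :=
  Finset.le_sup (f := id) (List.mem_toFinset.2 h)

/-- The hull of `B` contains `v`. -/
def Hits (v : ℕ) (B : List ℕ) : Prop := ∃ a ∈ B, ∃ b ∈ B, a ≤ v ∧ v ≤ b

theorem Hits.mono {v : ℕ} {B C : List ℕ} (h : Hits v B) (hBC : B ⊆ C) : Hits v C := by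
  obtain ⟨a, ha, b, hb, h⟩ := h
  exact ⟨a, hBC ha, b, hBC hb, h⟩

/-- At most `q` blocks have a hull containing any given value. -/
def CliqueLE {β : Type*} (q : ℕ) (js : List β) (F : β → List ℕ) : Prop :=
  ∀ v, ∀ s : List β, s.Nodup → (∀ j ∈ s, j ∈ js ∧ Hits v (F j)) → s.length ≤ q

/-- A maximal chain of pairwise disjoint hulls, found greedily by increasing minima. -/
theorem exists_greedy_chain {β : Type*} (js : List β) (mn mx : β → ℕ) (h : ∀ j, mn j ≤ mx j) :
    ∃ c : β → Prop,
      (∀ i ∈ js, ∀ j ∈ js, c i → c j → i ≠ j → mx i < mn j ∨ mx j < mn i) ∧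
      ∀ j ∈ js, ¬ c j → ∃ i ∈ js, c i ∧ mn i ≤ mn j ∧ mn j ≤ mx i := by
  induction hn : js.length using Nat.strong_induction_on generalizing js with
  | _ n ih =>
    by_cases hjs : js = []
    · subst hjs
      exact ⟨fun _ => False, by simp, by simp⟩
    -- The interval that begins first joins the chain; the recursion keeps only those beginning
    -- after it ends, and the dropped ones begin inside it.
    obtain ⟨a, ha, hmin⟩ : ∃ a ∈ js, ∀ b ∈ js, mn a ≤ mn b := by
      obtain ⟨a, ha, hm⟩ := Set.exists_min_image {x | x ∈ js} mn (List.finite_toSet js)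
        (List.exists_mem_of_ne_nil js hjs)
      exact ⟨a, ha, hm⟩
    have hlt : (js.filter fun b => mx a < mn b).length < n := by
      rw [← hn]
      refine lt_of_le_of_ne (List.length_filter_le _ _) fun e => ?_
      have := List.length_filter_eq_length_iff.1 e a ha
      have h' := h a
      simp only [decide_eq_true_eq] at this
      omega
    obtain ⟨c, h₁, h₂⟩ := ih _ hlt _ rfl
    refine ⟨fun b => b = a ∨ (c b ∧ mx a < mn b), ?_, ?_⟩
    · rintro i hi j hj (rfl | ⟨ci, hci⟩) (rfl | ⟨cj, hcj⟩) hij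
      · exact absurd rfl hij
      · exact Or.inl hcj
      · exact Or.inr hci
      · exact h₁ i (by simp [hi, hci]) j (by simp [hj, hcj]) ci cj hij
    · intro j hj hcj
      by_cases haj : mx a < mn j
      · obtain ⟨i, hi, ci, h₃⟩ := h₂ j (by simp [hj, haj]) fun h => hcj (Or.inr ⟨h, haj⟩)
        have hi' : i ∈ js ∧ mx a < mn i := by simpa using hi
        exact ⟨i, hi'.1, Or.inr ⟨ci, hi'.2⟩, h₃⟩
      · exact ⟨a, ha, Or.inl rfl, hmin j hj, not_lt.1 haj⟩

theorem exists_sorted_perm (l : List ℕ) (h : l.Nodup) :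
    ∃ l', l.Perm l' ∧ l'.Pairwise (· < ·) :=
  ⟨l.toFinset.sort, ((Finset.sort_perm_toList _ _).trans (List.toFinset_toList h)).symm,
    (Finset.sortedLT_sort _).pairwise⟩

theorem eq_of_perm_sorted {l l' : List ℕ} (h : l.Perm l') (hl : l.Pairwise (· < ·))
    (hl' : l'.Pairwise (· < ·)) : l = l' :=
  h.eq_of_pairwise (fun _ _ _ _ h h' => absurd h (lt_asymm h')) hl hl'

/-- Merging an increasing list with a decreasing one is a single separable rearrangement. -/
theorem exists_merge {a b : List ℕ} (ha : a.Pairwise (· < ·)) (hb : b.Pairwise (· < ·))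
    (hd : a.Disjoint b) :
    ∃ l, SepRel (a ++ b.reverse) l ∧ l.Pairwise (· < ·) := by
  have hn : (a ++ b).Nodup := List.nodup_append'.2
    ⟨ha.imp ne_of_lt, hb.imp ne_of_lt, hd⟩
  obtain ⟨l, hp, hs⟩ := exists_sorted_perm _ hn
  refine ⟨l, ?_, hs⟩
  have e₁ : l.filter (fun x => decide (x ∈ a)) = a := by
    refine eq_of_perm_sorted ?_ (hs.filter _) ha
    refine (hp.symm.filter _).trans ?_
    rw [List.filter_append, List.filter_eq_self.2 (by simp), List.filter_eq_nil_iff.2,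
      List.append_nil]
    intro x hx
    simpa using fun h => hd h hx
  have e₂ : l.filter (fun x => !decide (x ∈ a)) = b := by
    refine eq_of_perm_sorted ?_ (hs.filter _) hb
    refine (hp.symm.filter _).trans ?_
    rw [List.filter_append, List.filter_eq_nil_iff.2 (by simp), List.filter_eq_self.2,
      List.nil_append]
    intro x hx
    simpa using fun h => hd h hx
  -- Merging is the inverse of filtering the sorted list.
  have := (SepRel.filter (fun x => decide (x ∈ a)) l).symm
  rwa [e₁, e₂] at this

theorem flatMap_reverse_reverse {β : Type*} (l : List β) (F : β → List ℕ) :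
    l.reverse.flatMap (fun j => (F j).reverse) = (l.flatMap F).reverse := by
  induction l with
  | nil => rfl
  | cons a l ih => simp [ih]

theorem disjoint_of_nodup_flatMap {β : Type*} {js : List β} {F : β → List ℕ}
    (h : (js.flatMap F).Nodup) {i j : β} (hi : i ∈ js) (hj : j ∈ js) (hij : i ≠ j) :
    (F i).Disjoint (F j) := by
  have : Std.Symm (Function.onFun List.Disjoint F) := ⟨fun _ _ h => h.symm⟩
  exact (List.nodup_flatMap.1 h).2.forall hi hj hij

/-- Increasing blocks, consistently ordered, whose hulls overlap at most `q` times. -/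
theorem srt_of_cliqueLE {β : Type*} (q : ℕ) (js : List β) (F : β → List ℕ) (hj : js.Nodup)
    (hne : ∀ j ∈ js, F j ≠ []) (hs : ∀ j ∈ js, (F j).Pairwise (· < ·))
    (hn : (js.flatMap F).Nodup)
    (ho : js.Pairwise fun i j => ∃ a ∈ F i, ∃ b ∈ F j, a < b)
    (hq : CliqueLE q js F) : Srt (2 * (q - 1)) (js.flatMap F) := by
  classical
  induction q generalizing js with
  | zero =>
    match js, hne, hq with
    | [], _, _ => exact Srt.of_pairwise _ .nil
    | j :: js, hne, hq =>
      have hm := lmin_mem (hne j (by simp))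
      have := hq (lmin (F j)) [j] (by simp)
        (by simpa using ⟨_, hm, _, hm, le_rfl, le_rfl⟩)
      simp at this
  | succ q ih =>
    have hmm : ∀ j, lmin (F j) ≤ lmax (F j) := by
      intro j
      by_cases h : F j = []
      · simp [h, lmin, lmax]
      · exact lmin_le (lmax_mem h)
    obtain ⟨c, h₁, h₂⟩ := exists_greedy_chain js (fun j => lmin (F j)) (fun j => lmax (F j)) hmm
    set A := js.filter (fun j => decide (c j)) with hA
    set R := js.filter (fun j => !decide (c j)) with hR
    have mA : ∀ {j}, j ∈ A ↔ j ∈ js ∧ c j := by simp [hA]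
    have mR : ∀ {j}, j ∈ R ↔ j ∈ js ∧ ¬ c j := by simp [hR]
    -- Disjoint hulls are comparable, and `ho` rules out the wrong order.
    have hcA : A.Pairwise fun i j => ∀ x ∈ F i, ∀ y ∈ F j, x < y := by
      have h3 : A.Pairwise fun i j => (∃ a ∈ F i, ∃ b ∈ F j, a < b) ∧ i ≠ j :=
        (ho.filter _).and (hj.filter _)
      refine List.Pairwise.imp_of_mem ?_ h3
      rintro i j hi hj' ⟨⟨a, ha, b, hb, hab⟩, hij⟩ x hx y hy
      have hi := mA.1 hi
      have hj' := mA.1 hj'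
      rcases h₁ i hi.1 j hj'.1 hi.2 hj'.2 hij with h | h
      · exact ((le_lmax hx).trans_lt h).trans_le (lmin_le hy)
      · exact absurd hab (not_lt.2 (((le_lmax hb).trans h.le).trans (lmin_le ha)))
    have sA : (A.flatMap F).Pairwise (· < ·) :=
      List.pairwise_flatMap.2 ⟨fun j hj => hs j (mA.1 hj).1, hcA⟩
    -- In a clique of `R`, let `b` have the largest minimum. That minimum lies in the hull of every
    -- member and of some chain block `i`, so `i` enlarges the clique.
    have qR : CliqueLE q R F := by
      intro v s hsn hsv
      by_contra! hlt
      obtain ⟨b, hb, hmax⟩ : ∃ b ∈ s, ∀ b' ∈ s, lmin (F b') ≤ lmin (F b) := by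
        refine Set.exists_max_image {x | x ∈ s} (fun j => lmin (F j)) (List.finite_toSet s)
          (List.exists_mem_of_ne_nil s ?_)
        rintro rfl
        simp at hlt
      have hbR := mR.1 (hsv b hb).1
      obtain ⟨i, hi, ci, hi₁, hi₂⟩ := h₂ b hbR.1 hbR.2
      have := hq (lmin (F b)) (i :: s)
        (List.nodup_cons.2 ⟨fun h => (mR.1 (hsv i h).1).2 ci, hsn⟩) (by
          intro j hj
          rcases List.mem_cons.1 hj with rfl | hj
          · exact ⟨hi, _, lmin_mem (hne j hi), _, lmax_mem (hne j hi), hi₁, hi₂⟩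
          · obtain ⟨hjR, x, hx, y, hy, hxv, hvy⟩ := hsv j hj
            have hjj := mR.1 hjR
            obtain ⟨-, x', hx', -, -, hxv', -⟩ := hsv b hb
            exact ⟨hjj.1, _, lmin_mem (hne j hjj.1), y, hy, hmax j hj,
              ((lmin_le hx').trans hxv').trans hvy⟩)
      simp at this
      omega
    -- For `q = 0` no steps are available, while peeling and merging would cost two; but then the
    -- chain is everything.
    rcases Nat.eq_zero_or_pos q with rfl | hq0
    · have hRe : R = [] := by
        by_contra h
        obtain ⟨j, hjR⟩ := List.exists_mem_of_ne_nil R h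
        have hm := lmin_mem (hne j (mR.1 hjR).1)
        have := qR (lmin (F j)) [j] (by simp)
          (by simpa using ⟨hjR, _, hm, _, hm, le_rfl, le_rfl⟩)
        simp at this
      have : A = js := by
        rw [hA, List.filter_eq_self]
        intro j hj
        by_contra h
        have : j ∈ R := mR.2 ⟨hj, by simpa using h⟩
        simp [hRe] at this
      rw [← this]
      exact Srt.of_pairwise _ sA
    · have nR : (R.flatMap F).Nodup :=
        hn.sublist (List.Sublist.flatMap List.filter_sublist F)
      obtain ⟨t, ht, hts⟩ := ih R (hj.filter _) (fun j h => hne j (mR.1 h).1)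
        (fun j h => hs j (mR.1 h).1) nR (ho.filter _) qR
      have hd : (A.flatMap F).Disjoint t := by
        intro x hx hxt
        obtain ⟨i, hi, hxi⟩ := List.mem_flatMap.1 hx
        obtain ⟨j, hj', hxj⟩ := List.mem_flatMap.1 (ht.perm.mem_iff.2 hxt)
        have hij : i ≠ j := by
          rintro rfl
          exact (mR.1 hj').2 (mA.1 hi).2
        exact disjoint_of_nodup_flatMap hn (mA.1 hi).1 (mR.1 hj').1 hij hxi hxj
      obtain ⟨l, hl, hls⟩ := exists_merge sA hts hd
      refine ⟨l, ?_, hls⟩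
      -- Reversing the blocks of `R` as well as their order reverses the whole remainder. Sorted
      -- under this reversal, it ends up decreasing, as `exists_merge` requires.
      have s₁ : SepRel (js.flatMap F)
          (A.flatMap F ++ (R.flatMap F).reverse) := by
        have := (SepRel.filter (fun j => decide (c j)) js).flatMap (F := F)
          (F' := fun j => if c j then F j else (F j).reverse) (by
            intro j _
            split_ifs
            · exact .refl _
            · exact .self_reverse _)
        rw [List.flatMap_append, ← hA, ← hR] at this
        convert this using 2
        · refine List.flatMap_congr fun j hj => ?_
          simp [(mA.1 hj).2]
        · rw [← flatMap_reverse_reverse]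
          refine List.flatMap_congr fun j hj => ?_
          simp [(mR.1 (List.mem_reverse.1 hj)).2]
      have s₂ := (Steps.refl (2 * (q - 1)) (A.flatMap F)).append ht.reverse
      refine (((Steps.of_sepRel s₁).trans s₂).trans (Steps.of_sepRel hl)).mono ?_
      omega

/-! ### Crossing families of intervals -/

/-- Each list has an element strictly inside the hull of the other. -/
def Cross (A B : List ℕ) : Prop :=
  (∃ a ∈ A, ∃ b ∈ B, ∃ b' ∈ B, b < a ∧ a < b') ∧ ∃ b ∈ B, ∃ a ∈ A, ∃ a' ∈ A, a < b ∧ b < a'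

theorem Cross.symm {A B : List ℕ} (h : Cross A B) : Cross B A := ⟨h.2, h.1⟩

theorem Cross.mono {A A' B B' : List ℕ} (h : Cross A B) (hA : A ⊆ A') (hB : B ⊆ B') :
    Cross A' B' := by
  obtain ⟨⟨a, ha, b, hb, b', hb', h⟩, c, hc, d, hd, d', hd', h'⟩ := h
  exact ⟨⟨a, hA ha, b, hB hb, b', hB hb', h⟩, c, hB hc, d, hA hd, d', hA hd', h'⟩

/-- There are no `k` disjoint intervals of positions of size at least two whose values cross
pairwise. -/
def CrossFree (k : ℕ) (l : List ℕ) : Prop :=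
  ∀ Ys : List (List ℕ), Ys.flatten.Sublist l → (∀ Y ∈ Ys, 2 ≤ Y.length) → Ys.Pairwise Cross →
    Ys.length < k

theorem CrossFree.sublist {k : ℕ} {l l' : List ℕ} (h : CrossFree k l) (hl : l'.Sublist l) :
    CrossFree k l' :=
  fun Ys hYs => h Ys (hYs.trans hl)

/-- Disjoint intervals can be enlarged so as to cover all positions. -/
theorem exists_expand {Ys : List (List ℕ)} {m : List ℕ} (hne : Ys ≠ [])
    (h : Ys.flatten.Sublist m) :
    ∃ Ws : List (List ℕ), Ws.flatten = m ∧ List.Forall₂ List.Sublist Ys Ws := by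
  induction Ys generalizing m with
  | nil => exact absurd rfl hne
  | cons Y Ys ih =>
    rw [List.flatten_cons, List.append_sublist_iff] at h
    obtain ⟨r₁, r₂, rfl, h₁, h₂⟩ := h
    by_cases hY : Ys = []
    · subst hY
      exact ⟨[r₁ ++ r₂], by simp, .cons (h₁.trans (List.sublist_append_left _ _)) .nil⟩
    · obtain ⟨Ws, rfl, hW⟩ := ih hY h₂
      exact ⟨r₁ :: Ws, rfl, .cons h₁ hW⟩

theorem exists_of_forall₂_right {α β : Type*} {R : α → β → Prop} {l : List α} {l' : List β}
    (h : List.Forall₂ R l l') {b : β} (hb : b ∈ l') : ∃ a ∈ l, R a b := by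
  induction h with
  | nil => simp at hb
  | cons h _ ih =>
    rcases List.mem_cons.1 hb with rfl | hb
    · exact ⟨_, by simp, h⟩
    · obtain ⟨a, ha, h⟩ := ih hb
      exact ⟨a, by simp [ha], h⟩

theorem pairwise_cross_of_forall₂ {Ys Ws : List (List ℕ)}
    (h : List.Forall₂ List.Sublist Ys Ws) (hY : Ys.Pairwise Cross) : Ws.Pairwise Cross := by
  induction h with
  | nil => exact .nil
  | cons h₁ h₂ ih =>
    rw [List.pairwise_cons] at hY ⊢
    refine ⟨fun W hW => ?_, ih hY.2⟩
    obtain ⟨Y, hY', hYW⟩ := exists_of_forall₂_right h₂ hW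
    exact (hY.1 Y hY').mono h₁.subset hYW.subset

/-- Intervals that meet one gap of a monotone function around a common value and also leave that
gap. -/
theorem length_le_of_gap {k : ℕ} {m : List ℕ} (hm : m.Nodup) (hk : CrossFree (k + 1) m)
    {γ : ℕ → ℕ} (hγ : Monotone γ) (g v : ℕ) {Ws : List (List ℕ)} (hW : Ws.flatten.Sublist m)
    (h : ∀ W ∈ Ws, (∃ a ∈ W, ∃ b ∈ W, a ≤ v ∧ v ≤ b ∧ γ a = g ∧ γ b = g) ∧ ∃ w ∈ W, γ w ≠ g) :
    Ws.length ≤ 2 * k := by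
  classical
  have hn : Ws.Pairwise List.Disjoint := (List.nodup_flatten.1 (hm.sublist hW)).2
  have lt_of : ∀ {x y}, γ x < γ y → x < y := fun hxy => by
    by_contra hh
    exact absurd (hγ (not_lt.1 hh)) (not_le.2 hxy)
  have two : ∀ W ∈ Ws, 2 ≤ W.length := by
    intro W hW'
    obtain ⟨⟨a, ha, -, -, -, -, hag, -⟩, w, hw, hwg⟩ := h W hW'
    match W, ha, hw with
    | [x], ha, hw =>
      simp only [List.mem_singleton] at ha hw
      subst ha hw
      exact absurd hag hwg
    | _ :: _ :: _, _, _ => simp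
  have key : ∀ p : List ℕ → Bool, (Ws.filter p).Pairwise Cross → (Ws.filter p).length ≤ k := by
    intro p hp
    refine Nat.lt_succ_iff.1 (hk _ ?_ (fun Y hY => two Y (List.mem_filter.1 hY).1) hp)
    exact (List.Sublist.flatten List.filter_sublist).trans hW
  -- Intervals leaving the gap upwards cross pairwise: a value of one that is in the gap and at
  -- least `v` lies between a value of the other at most `v` and its value above the gap. Those
  -- leaving downwards are symmetric, whence the factor two.
  have h₁ := key (fun W => decide (∃ w ∈ W, g < γ w)) (by
    refine List.Pairwise.imp_of_mem ?_ (hn.filter _)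
    intro A B hA hB hAB
    simp only [List.mem_filter, decide_eq_true_eq] at hA hB
    obtain ⟨⟨a, ha, b, hb, hav, hvb, hag, hbg⟩, -⟩ := h A hA.1
    obtain ⟨⟨c, hc, d, hd, hcv, hvd, hcg, hdg⟩, -⟩ := h B hB.1
    obtain ⟨-, w, hw, hwg⟩ := hA
    obtain ⟨-, z, hz, hzg⟩ := hB
    have hcb : c ≠ b := fun e => hAB hb (e ▸ hc)
    have had : a ≠ d := fun e => hAB ha (e ▸ hd)
    exact ⟨⟨b, hb, c, hc, z, hz, by omega, lt_of (by omega)⟩,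
      ⟨d, hd, a, ha, w, hw, by omega, lt_of (by omega)⟩⟩)
  have h₂ := key (fun W => !decide (∃ w ∈ W, g < γ w)) (by
    refine List.Pairwise.imp_of_mem ?_ (hn.filter _)
    intro A B hA hB hAB
    simp only [List.mem_filter, Bool.not_eq_true', decide_eq_false_iff_not, not_exists, not_and,
      not_lt] at hA hB
    obtain ⟨⟨a, ha, b, hb, hav, hvb, hag, hbg⟩, w, hw, hwg⟩ := h A hA.1
    obtain ⟨⟨c, hc, d, hd, hcv, hvd, hcg, hdg⟩, z, hz, hzg⟩ := h B hB.1
    have hwg' := hA.2 w hw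
    have hzg' := hB.2 z hz
    have hcb : c ≠ b := fun e => hAB hb (e ▸ hc)
    have had : a ≠ d := fun e => hAB ha (e ▸ hd)
    exact ⟨⟨a, ha, z, hz, d, hd, lt_of (by omega), by omega⟩,
      ⟨c, hc, w, hw, b, hb, lt_of (by omega), by omega⟩⟩)
  have := List.length_eq_length_filter_add (l := Ws) (fun W => decide (∃ w ∈ W, g < γ w))
  omega

/-! ### Bounded oscillation and the Cartesian tree -/

/-- Fewer than `q` disjoint intervals of positions have values on both sides of any given
level. -/
def LevelFree (q : ℕ) (l : List ℕ) : Prop :=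
  ∀ v, ∀ Ys : List (List ℕ), Ys.flatten.Sublist l →
    (∀ Y ∈ Ys, ∃ a ∈ Y, ∃ b ∈ Y, a < v ∧ v ≤ b) → Ys.length < q

theorem LevelFree.sublist {q : ℕ} {l l' : List ℕ} (h : LevelFree q l) (hl : l'.Sublist l) :
    LevelFree q l' :=
  fun v Ys hYs => h v Ys (hYs.trans hl)

/-- The block hanging at a vertex of the main path of the Cartesian tree: the hanging values, the
vertex, and whether the hanging values stand before the vertex. -/
abbrev PathBlock := List ℕ × ℕ × Bool

/-- The values of a path block, with the vertex last. -/
def PathBlock.toList (g : PathBlock) : List ℕ := g.1 ++ [g.2.1]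

/-- The values of a path block in order of position. -/
def PathBlock.inOrder (g : PathBlock) : List ℕ := bif g.2.2 then g.1 ++ [g.2.1] else g.2.1 :: g.1

theorem PathBlock.inOrder_perm (g : PathBlock) : g.inOrder.Perm g.toList := by
  obtain ⟨h, x, b⟩ := g
  cases b
  · exact (List.perm_append_singleton x h).symm
  · exact .refl _

/-- Any level straddled inside `A` lies between `c` and `x`, so `B` is one further straddling
interval. For the empty family the level `x` yields `0 < q`. -/
theorem levelFree_of_straddle {q : ℕ} {l A B : List ℕ} (h : LevelFree (q + 1) l)
    (hl : l = A ++ B ∨ l = B ++ A) {c x : ℕ} (hc : c ∈ B) (hx : x ∈ B) (hcx : c < x)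
    (hcA : ∀ a ∈ A, c ≤ a) (hxA : ∀ a ∈ A, a ≤ x) : LevelFree q A := by
  intro v Ys hY hv
  obtain ⟨u, hu, hYu⟩ : ∃ u, (c < u ∧ u ≤ x) ∧ ∀ Y ∈ Ys, ∃ a ∈ Y, ∃ b ∈ Y, a < u ∧ u ≤ b := by
    match Ys, hY, hv with
    | [], _, _ => exact ⟨x, ⟨hcx, le_rfl⟩, by simp⟩
    | Y :: Ys, hY, hv =>
      refine ⟨v, ?_, hv⟩
      obtain ⟨a, ha, b, hb, hav, hvb⟩ := hv Y (by simp)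
      have ha' := hcA a (hY.subset (by simp [ha]))
      have hb' := hxA b (hY.subset (by simp [hb]))
      omega
  have hB : ∃ a ∈ B, ∃ b ∈ B, a < u ∧ u ≤ b := ⟨c, hc, x, hx, hu⟩
  rcases hl with rfl | rfl
  · have := h u (Ys ++ [B]) (by simpa using hY)
      (by simpa [or_imp, forall_and] using ⟨hYu, hB⟩)
    simpa using this
  · have := h u (B :: Ys) (by simpa using hY)
      (by simpa [or_imp, forall_and] using ⟨hB, hYu⟩)
    simpa using this

/-- The main path of the Cartesian tree: descending from the maximum towards the minimum, all
hanging intervals of positions are simpler. -/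
theorem exists_path {q : ℕ} (l : List ℕ) (hn : l.Nodup) (h : LevelFree (q + 1) l) :
    ∃ Gs Qs : List PathBlock, SepRel l (Gs.flatMap PathBlock.toList) ∧
      (∀ g ∈ Gs, (g.1 = [] ∨ LevelFree q g.1) ∧ ∀ a ∈ g.1, a < g.2.1) ∧
      Gs.Pairwise (fun g g' => g.2.1 < g'.2.1) ∧ Qs.Perm Gs ∧
      Qs.flatMap PathBlock.inOrder = l := by
  induction hlen : l.length using Nat.strong_induction_on generalizing l with
  | _ n ih =>
    by_cases hl : l = []
    · subst hl
      exact ⟨[], [], .nil, by simp, .nil, .nil, rfl⟩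
    have hx := lmax_mem hl
    have hmax : ∀ a ∈ l, a ≤ lmax l := fun a ha => le_lmax ha
    generalize lmax l = x at hx hmax
    obtain ⟨L, R, rfl⟩ := List.append_of_mem hx
    obtain ⟨hnL, hnR, hLR⟩ := List.nodup_append'.1 hn
    obtain ⟨hxR, hnR⟩ := List.nodup_cons.1 hnR
    have ltL : ∀ a ∈ L, a < x := fun a ha => lt_of_le_of_ne (hmax a (by simp [ha])) (by
      rintro rfl
      exact hLR ha (by simp))
    have ltR : ∀ a ∈ R, a < x := fun a ha => lt_of_le_of_ne (hmax a (by simp [ha])) (by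
      rintro rfl
      exact hxR ha)
    -- The path continues into `L`, and `R` hangs at `x`. The empty case is listed separately
    -- because `LevelFree 0` fails even for the empty list.
    have goL : (R = [] ∨ LevelFree q R) → ∃ Gs Qs : List PathBlock,
        SepRel (L ++ x :: R) (Gs.flatMap PathBlock.toList) ∧
        (∀ g ∈ Gs, (g.1 = [] ∨ LevelFree q g.1) ∧ ∀ a ∈ g.1, a < g.2.1) ∧
        Gs.Pairwise (fun g g' => g.2.1 < g'.2.1) ∧ Qs.Perm Gs ∧
        Qs.flatMap PathBlock.inOrder = L ++ x :: R := by
      intro hR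
      obtain ⟨Gs, Qs, h₁, h₂, h₃, h₄, h₅⟩ := ih L.length (by simp at hlen; omega) L hnL
        (h.sublist (List.sublist_append_left _ _)) rfl
      refine ⟨Gs ++ [(R, x, false)], Qs ++ [(R, x, false)], ?_, ?_, ?_, h₄.append_right _, ?_⟩
      · have := h₁.sum ((SepRel.single x).skew (SepRel.refl R))
        simpa [PathBlock.toList] using this
      · intro g hg
        rcases List.mem_append.1 hg with hg | hg
        · exact h₂ g hg
        · obtain rfl := List.mem_singleton.1 hg
          exact ⟨hR, ltR⟩
      · refine List.pairwise_append.2 ⟨h₃, by simp, fun g hg g' hg' => ?_⟩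
        obtain rfl := List.mem_singleton.1 hg'
        refine ltL _ (h₁.perm.mem_iff.2 (List.mem_flatMap.2 ⟨g, hg, ?_⟩))
        simp [PathBlock.toList]
      · simp [h₅, PathBlock.inOrder]
    have goR : (L = [] ∨ LevelFree q L) → ∃ Gs Qs : List PathBlock,
        SepRel (L ++ x :: R) (Gs.flatMap PathBlock.toList) ∧
        (∀ g ∈ Gs, (g.1 = [] ∨ LevelFree q g.1) ∧ ∀ a ∈ g.1, a < g.2.1) ∧
        Gs.Pairwise (fun g g' => g.2.1 < g'.2.1) ∧ Qs.Perm Gs ∧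
        Qs.flatMap PathBlock.inOrder = L ++ x :: R := by
      intro hL
      obtain ⟨Gs, Qs, h₁, h₂, h₃, h₄, h₅⟩ := ih R.length (by simp at hlen; omega) R hnR
        (h.sublist ((List.sublist_cons_self _ _).trans (List.sublist_append_right _ _))) rfl
      refine ⟨Gs ++ [(L, x, true)], (L, x, true) :: Qs, ?_, ?_, ?_,
        (h₄.cons _).trans (List.perm_append_singleton _ _).symm, ?_⟩
      · have := ((SepRel.refl L).sum (SepRel.single x)).skew h₁
        simpa [PathBlock.toList] using this
      · intro g hg
        rcases List.mem_append.1 hg with hg | hg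
        · exact h₂ g hg
        · obtain rfl := List.mem_singleton.1 hg
          exact ⟨hL, ltL⟩
      · refine List.pairwise_append.2 ⟨h₃, by simp, fun g hg g' hg' => ?_⟩
        obtain rfl := List.mem_singleton.1 hg'
        refine ltR _ (h₁.perm.mem_iff.2 (List.mem_flatMap.2 ⟨g, hg, ?_⟩))
        simp [PathBlock.toList]
      · simp [h₅, PathBlock.inOrder]
    by_cases hL : L = []
    · exact goR (Or.inl hL)
    by_cases hR : R = []
    · exact goL (Or.inl hR)
    have mL := lmin_mem hL
    have mR := lmin_mem hR
    -- The side with the larger minimum hangs: the other side together with `x` straddles all its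
    -- levels.
    rcases le_total (lmin L) (lmin R) with hle | hle
    · refine goL (Or.inr (levelFree_of_straddle h (B := L ++ [x]) (Or.inr (by simp))
        (List.mem_append_left _ mL) (by simp) (ltL _ mL) (fun a ha => hle.trans (lmin_le ha))
        fun a ha => (ltR a ha).le))
    · refine goR (Or.inr (levelFree_of_straddle h (B := x :: R) (Or.inl rfl)
        (List.mem_cons_of_mem _ mR) (by simp) (ltR _ mR) (fun a ha => hle.trans (lmin_le ha))
        fun a ha => (ltL a ha).le))

theorem length_le_one_of_nodup {β : Type*} {s : List β} (hs : s.Nodup)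
    (h : ∀ a ∈ s, ∀ b ∈ s, a = b) : s.length ≤ 1 := by
  match s, hs, h with
  | [], _, _ => simp
  | [a], _, _ => simp
  | a :: b :: t, hs, h =>
    have := h a (by simp) b (by simp)
    subst this
    simp at hs

/-- The path blocks are sorted recursively in parallel and then merged. In the inductive step at
most `q + 1` blocks straddle a value and at most one has it as minimum, so the overlap is at most `q
+ 2`. The cost grows by `1 + 2 * (q + 1)`: one step to reach the path order, the rest for merging.
-/
theorem srt_of_levelFree (q : ℕ) {l : List ℕ} (hn : l.Nodup) (h : LevelFree (q + 1) l) :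
    Srt (q * q + 2 * q) l := by
  classical
  induction q generalizing l with
  | zero =>
    refine Srt.of_length_le_one _ (length_le_one_of_nodup hn fun a ha b hb => ?_)
    by_contra hab
    rcases lt_or_gt_of_ne hab with hab | hab
    · simpa using h b [l] (by simp) (by simpa using ⟨a, ha, b, hb, hab, le_rfl⟩)
    · simpa using h a [l] (by simp) (by simpa using ⟨b, hb, a, ha, hab, le_rfl⟩)
  | succ q ih =>
    obtain ⟨Gs, Qs, h₁, h₂, h₃, h₄, h₅⟩ := exists_path l hn h
    have hnG : (Gs.flatMap PathBlock.toList).Nodup := h₁.perm.nodup_iff.1 hn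
    have hS : ∀ g, ∃ S, g ∈ Gs → Steps (q * q + 2 * q) g.toList S ∧ S.Pairwise (· < ·) := by
      intro g
      by_cases hg : g ∈ Gs
      swap
      · exact ⟨[], fun h => absurd h hg⟩
      have : Srt (q * q + 2 * q) g.toList := by
        refine Srt.append ?_ (Srt.of_pairwise _ (by simp)) ?_
        · rcases (h₂ g hg).1 with e | hf
          · rw [e]
            exact Srt.of_pairwise _ .nil
          · refine ih ?_ hf
            refine ((List.nodup_flatMap.1 hnG).1 g hg).sublist ?_
            exact List.sublist_append_left _ _
        · intro a ha b hb
          rw [List.mem_singleton.1 hb]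
          exact (h₂ g hg).2 a ha
      obtain ⟨S, hS⟩ := this
      exact ⟨S, fun _ => hS⟩
    choose S hS using hS
    have hst : Steps (q * q + 2 * q) (Gs.flatMap PathBlock.toList) (Gs.flatMap S) :=
      Steps.flatMap_right _ fun g hg => (hS g hg).1
    have memS : ∀ {g}, g ∈ Gs → ∀ {a}, a ∈ S g ↔ a ∈ g.toList :=
      fun hg _ => (hS _ hg).1.perm.mem_iff.symm
    have hGn : Gs.Nodup := h₃.imp fun hlt e => by simp [e] at hlt
    have := srt_of_cliqueLE (q + 2) Gs S hGn
      (fun g hg e => by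
        have : g.2.1 ∈ S g := (memS hg).2 (by simp [PathBlock.toList])
        simp [e] at this)
      (fun g hg => (hS g hg).2) (hst.perm.nodup_iff.1 hnG)
      (h₃.imp_of_mem fun {g g'} hg hg' hlt =>
        ⟨g.2.1, (memS hg).2 (by simp [PathBlock.toList]), g'.2.1,
          (memS hg').2 (by simp [PathBlock.toList]), hlt⟩)
      (by
        intro v s hs hsv
        have e := List.length_eq_length_filter_add (l := s)
          (fun g : PathBlock => decide (∃ a ∈ g.toList, a < v))
        have b₁ : (s.filter (fun g : PathBlock => !decide (∃ a ∈ g.toList, a < v))).length ≤ 1 := by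
          have hv : ∀ g ∈ s.filter (fun g : PathBlock => !decide (∃ a ∈ g.toList, a < v)),
              g ∈ Gs ∧ v ∈ g.toList := by
            intro g hg
            simp only [List.mem_filter, Bool.not_eq_true', decide_eq_false_iff_not, not_exists,
              not_and, not_lt] at hg
            obtain ⟨hgG, a, ha, -, -, hav, -⟩ := hsv g hg.1
            rw [memS hgG] at ha
            refine ⟨hgG, ?_⟩
            rwa [← le_antisymm hav (hg.2 a ha)]
          refine length_le_one_of_nodup (hs.filter _) fun g hg g' hg' => ?_
          by_contra hne
          exact disjoint_of_nodup_flatMap hnG (hv g hg).1 (hv g' hg').1 hne (hv g hg).2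
            (hv g' hg').2
        have b₂ : (s.filter (fun g : PathBlock => decide (∃ a ∈ g.toList, a < v))).length ≤
            q + 1 := by
          have hsn := hs.filter (fun g : PathBlock => decide (∃ a ∈ g.toList, a < v))
          generalize hs' :
            s.filter (fun g : PathBlock => decide (∃ a ∈ g.toList, a < v)) = s' at hsn
          -- `LevelFree` needs the blocks in order of position, which `Qs` records and `Gs` does
          -- not.
          have hp : (Qs.filter (fun g => decide (g ∈ s'))).Perm s' := by
            rw [List.perm_ext_iff_of_nodup ((h₄.nodup_iff.2 hGn).filter _) hsn]
            intro g
            simp only [List.mem_filter, decide_eq_true_eq, and_iff_right_iff_imp]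
            intro hg
            rw [← hs'] at hg
            exact h₄.mem_iff.2 (hsv g (List.mem_filter.1 hg).1).1
          have := h v ((Qs.filter (fun g => decide (g ∈ s'))).map PathBlock.inOrder)
            (by
              rw [← List.flatMap_def, ← h₅]
              exact List.Sublist.flatMap List.filter_sublist _)
            (by
              intro Y hY
              obtain ⟨g, hg, rfl⟩ := List.mem_map.1 hY
              have hg' := hp.mem_iff.1 hg
              rw [← hs', List.mem_filter, decide_eq_true_eq] at hg'
              obtain ⟨hgs, a, ha, hav⟩ := hg'
              obtain ⟨hgG, -, -, b, hb, -, hvb⟩ := hsv g hgs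
              rw [memS hgG] at hb
              exact ⟨a, g.inOrder_perm.mem_iff.2 ha, b, g.inOrder_perm.mem_iff.2 hb, hav, hvb⟩)
          rw [List.length_map, hp.length_eq] at this
          omega
        omega)
    refine (Srt.of_steps ((Steps.of_sepRel h₁).trans hst) this).mono ?_
    have : q + 2 - 1 = q + 1 := rfl
    rw [this]
    nlinarith

/-! ### Blocks in single gaps of a monotone function -/

/-- A decomposition of the list `p` into maximal intervals on which `κ` is constant. -/
structure IsBlocks {β δ : Type*} (κ : β → δ) (p : List β) (Js : List (List β)) : Prop where
  flatten : Js.flatten = p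
  ne_nil : ∀ J ∈ Js, J ≠ []
  const : ∀ J ∈ Js, ∀ a ∈ J, ∀ b ∈ J, κ a = κ b
  chain : Js.IsChain fun A B => ∀ a ∈ A, ∀ b ∈ B, κ a ≠ κ b

theorem exists_isBlocks {β δ : Type*} (κ : β → δ) (p : List β) : ∃ Js, IsBlocks κ p Js := by
  induction p with
  | nil => exact ⟨[], rfl, by simp, by simp, .nil⟩
  | cons a p ih =>
    obtain ⟨Js, rfl, h₁, h₂, h₃⟩ := ih
    match Js, h₁, h₂, h₃ with
    | [], _, _, _ => exact ⟨[[a]], rfl, by simp, by simp, .singleton _⟩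
    | J :: Js, h₁, h₂, h₃ =>
      obtain ⟨b, hb⟩ := List.exists_mem_of_ne_nil J (h₁ J (by simp))
      have hJ : ∀ c ∈ J, κ c = κ b := fun c hc => h₂ J (by simp) c hc b hb
      by_cases hab : κ a = κ b
      · have hJ' : ∀ c ∈ a :: J, κ c = κ b := by
          intro c hc
          rcases List.mem_cons.1 hc with rfl | hc
          · exact hab
          · exact hJ c hc
        refine ⟨(a :: J) :: Js, by simp, ?_, ?_, ?_⟩
        · intro K hK
          rcases List.mem_cons.1 hK with rfl | hK
          · simp
          · exact h₁ K (by simp [hK])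
        · intro K hK
          rcases List.mem_cons.1 hK with rfl | hK
          · intro x hx y hy
            rw [hJ' x hx, hJ' y hy]
          · exact h₂ K (by simp [hK])
        · rw [List.isChain_cons] at h₃ ⊢
          refine ⟨fun K hK x hx y hy => ?_, h₃.2⟩
          rw [hJ' x hx]
          exact h₃.1 K hK b hb y hy
      · refine ⟨[a] :: J :: Js, by simp, ?_, ?_, ?_⟩
        · intro K hK
          rcases List.mem_cons.1 hK with rfl | hK
          · simp
          · exact h₁ K hK
        · intro K hK
          rcases List.mem_cons.1 hK with rfl | hK
          · simp
          · exact h₂ K hK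
        · rw [List.isChain_cons_cons]
          refine ⟨fun x hx y hy => ?_, h₃⟩
          rw [List.mem_singleton.1 hx, hJ y hy]
          exact hab

theorem map_lmin_sublist {Js : List (List ℕ)} (h : ∀ J ∈ Js, J ≠ []) :
    (Js.map lmin).Sublist Js.flatten := by
  induction Js with
  | nil => simp
  | cons J Js ih =>
    have h₁ : [lmin J].Sublist J := List.singleton_sublist.2 (lmin_mem (h J (by simp)))
    simpa using h₁.append (ih fun K hK => h K (by simp [hK]))

namespace IsBlocks

variable {δ : Type*} {κ : ℕ → δ} {p : List ℕ} {Js : List (List ℕ)}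

theorem lmin_sublist (h : IsBlocks κ p Js) : (Js.map lmin).Sublist p := by
  have := map_lmin_sublist h.ne_nil
  rwa [h.flatten] at this

theorem lmin_chain (h : IsBlocks κ p Js) : (Js.map lmin).IsChain (κ · ≠ κ ·) := by
  rw [List.isChain_map]
  exact h.chain.imp_of_mem_imp fun A B hA hB hAB =>
    hAB _ (lmin_mem (h.ne_nil A hA)) _ (lmin_mem (h.ne_nil B hB))

theorem isInfix {β : Type*} {κ : β → δ} {p : List β} {Js : List (List β)} (h : IsBlocks κ p Js)
    {J : List β} (hJ : J ∈ Js) : J <:+: p :=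
  h.flatten ▸ List.infix_of_mem_flatten hJ

theorem nodup (h : IsBlocks κ p Js) (hp : p.Nodup) : Js.Nodup := by
  have hn : Js.flatten.Nodup := h.flatten.symm ▸ hp
  refine (List.nodup_flatten.1 hn).2.imp_of_mem ?_
  rintro A B hA - hAB rfl
  obtain ⟨a, ha⟩ := List.exists_mem_of_ne_nil A (h.ne_nil A hA)
  exact hAB ha ha

theorem disjoint (h : IsBlocks κ p Js) (hp : p.Nodup) {A B : List ℕ} (hA : A ∈ Js) (hB : B ∈ Js)
    (hAB : A ≠ B) : A.Disjoint B := by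
  have hn : (Js.flatMap id).Nodup := by
    rw [List.flatMap_id]
    exact h.flatten.symm ▸ hp
  exact disjoint_of_nodup_flatMap hn hA hB hAB

end IsBlocks

/-- Blocks in a common gap, each extended by its successor. -/
theorem exists_extended_blocks {γ : ℕ → ℕ} (g : ℕ) (P : List ℕ → Bool) (Js : List (List ℕ))
    (hne : ∀ J ∈ Js, J ≠ []) (hP : ∀ J ∈ Js, P J = true → ∀ a ∈ J, γ a = g)
    (hc : Js.IsChain fun A B => ∀ a ∈ A, ∀ b ∈ B, γ a ≠ γ b) :
    ∃ Ws : List (List ℕ), Ws.flatten.Sublist Js.flatten ∧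
      (∀ W ∈ Ws, (∃ J ∈ Js, P J = true ∧ J ⊆ W) ∧ ∃ w ∈ W, γ w ≠ g) ∧
      (Js.filter P).length ≤ Ws.length + 1 := by
  induction hn : Js.length using Nat.strong_induction_on generalizing Js with
  | _ n ih =>
    match Js, hne, hP, hc, hn with
    | [], _, _, _, _ => exact ⟨[], by simp, by simp, by simp⟩
    | [J], _, _, _, _ => exact ⟨[], by simp, by simp, by simpa using List.length_filter_le P [J]⟩
    | J :: K :: Js, hne, hP, hc, hn =>
      rw [List.isChain_cons_cons] at hc
      cases hJ : P J
      · obtain ⟨Ws, h₁, h₂, h₃⟩ := ih (K :: Js).length (by simp at hn ⊢; omega) (K :: Js)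
          (fun L hL => hne L (List.mem_cons_of_mem _ hL))
          (fun L hL => hP L (List.mem_cons_of_mem _ hL)) hc.2 rfl
        refine ⟨Ws, h₁.trans (by simp), fun W hW => ?_, ?_⟩
        · obtain ⟨⟨L, hL, h⟩, hw⟩ := h₂ W hW
          exact ⟨⟨L, List.mem_cons_of_mem _ hL, h⟩, hw⟩
        · rwa [List.filter_cons_of_neg (by simp [hJ])]
      -- The successor `K` lies outside the gap `g` and so is not itself selected. Only a final
      -- block lacks a successor, hence the `+ 1`.
      · obtain ⟨a, ha⟩ := List.exists_mem_of_ne_nil J (hne J (by simp))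
        obtain ⟨b, hb⟩ := List.exists_mem_of_ne_nil K (hne K (by simp))
        have hag := hP J (by simp) hJ a ha
        have hbg : γ b ≠ g := hag ▸ (hc.1 a ha b hb).symm
        have hK : P K = false := by
          by_contra h
          exact hbg (hP K (by simp) (by simpa using h) b hb)
        obtain ⟨Ws, h₁, h₂, h₃⟩ := ih Js.length (by simp at hn; omega) Js
          (fun L hL => hne L (by simp [hL])) (fun L hL => hP L (by simp [hL])) hc.2.tail rfl
        refine ⟨(J ++ K) :: Ws, ?_, ?_, ?_⟩
        · simpa using h₁
        · intro W hW
          rcases List.mem_cons.1 hW with rfl | hW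
          · exact ⟨⟨J, by simp, hJ, by simp⟩, b, by simp [hb], hbg⟩
          · obtain ⟨⟨L, hL, h⟩, hw⟩ := h₂ W hW
            exact ⟨⟨L, by simp [hL], h⟩, hw⟩
        · rw [List.filter_cons_of_pos (by simp [hJ]), List.filter_cons_of_neg (by simp [hK])]
          simpa using h₃

/-- By monotonicity, blocks whose hulls contain `v` lie in the gap of `v`. Extended by their
successors, all but possibly the last leave that gap, and `length_le_of_gap` applies. -/
theorem IsBlocks.cliqueLE {k : ℕ} {γ : ℕ → ℕ} (hγ : Monotone γ) {p : List ℕ}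
    {Js : List (List ℕ)} (h : IsBlocks γ p Js) (hp : p.Nodup) (hk : CrossFree (k + 1) p) :
    CliqueLE (2 * k + 1) Js id := by
  classical
  intro v s hs hsv
  have hg : ∀ J ∈ s, ∀ c ∈ J, γ c = γ v := by
    intro J hJ c hc
    obtain ⟨hJs, a, ha, b, hb, hav, hvb⟩ := hsv J hJ
    refine le_antisymm ?_ ?_
    · rw [h.const J hJs c hc a ha]
      exact hγ hav
    · rw [h.const J hJs c hc b hb]
      exact hγ hvb
  obtain ⟨Ws, h₁, h₂, h₃⟩ := exists_extended_blocks (γ := γ) (γ v) (fun J => decide (J ∈ s)) Js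
    h.ne_nil (fun J _ hJ => hg J (by simpa using hJ)) h.chain
  have hpm : (Js.filter fun J => decide (J ∈ s)).Perm s := by
    rw [List.perm_ext_iff_of_nodup ((h.nodup hp).filter _) hs]
    intro J
    simp only [List.mem_filter, decide_eq_true_eq, and_iff_right_iff_imp]
    exact fun hJ => (hsv J hJ).1
  have := length_le_of_gap hp hk hγ (γ v) v (h.flatten ▸ h₁) (by
    intro W hW
    obtain ⟨⟨J, -, hJ, hJW⟩, hw⟩ := h₂ W hW
    have hJs : J ∈ s := by simpa using hJ
    obtain ⟨-, a, ha, b, hb, hav, hvb⟩ := hsv J hJs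
    exact ⟨⟨a, hJW ha, b, hJW hb, hav, hvb, hg J hJs a ha, hg J hJs b hb⟩, hw⟩)
  rw [← hpm.length_eq]
  omega

theorem exists_ne_of_chain {γ : ℕ → ℕ} {W : List ℕ} (hc : W.IsChain (γ · ≠ γ ·))
    (h : 2 ≤ W.length) : ∃ x ∈ W, ∃ y ∈ W, γ x ≠ γ y := by
  match W, hc, h with
  | x :: y :: W, hc, _ =>
    rw [List.isChain_cons_cons] at hc
    exact ⟨x, by simp, y, by simp, hc.1⟩

theorem two_le_length_of_ne {l : List ℕ} {a b : ℕ} (ha : a ∈ l) (hb : b ∈ l) (hab : a ≠ b) :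
    2 ≤ l.length := by
  match l, ha, hb with
  | [x], ha, hb => exact absurd ((List.mem_singleton.1 ha).trans (List.mem_singleton.1 hb).symm) hab
  | _ :: _ :: _, _, _ => simp

/-- The values of a list in one gap of `γ` oscillate boundedly, if neighbours lie in different
gaps. -/
theorem levelFree_gap {k : ℕ} {m : List ℕ} (hm : m.Nodup) (hk : CrossFree (k + 1) m)
    {γ : ℕ → ℕ} (hγ : Monotone γ) (hc : m.IsChain (γ · ≠ γ ·)) (g : ℕ) {q : List ℕ}
    (hq : q.Sublist m) (hg : ∀ a ∈ q, γ a = g) : LevelFree (2 * k + 1) q := by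
  intro v Ys hY hv
  by_cases hYs : Ys = []
  · subst hYs
    simp
  obtain ⟨Ws, hWm, hYW⟩ := exists_expand hYs (hY.trans hq)
  rw [hYW.length_eq]
  refine Nat.lt_succ_iff.2 (length_le_of_gap hm hk hγ g v (hWm ▸ .refl _) fun W hW => ?_)
  obtain ⟨Y, hYm, hs⟩ := exists_of_forall₂_right hYW hW
  obtain ⟨a, ha, b, hb, hav, hvb⟩ := hv Y hYm
  have hYq : ∀ c ∈ Y, γ c = g := fun c hc => hg c (hY.subset (List.mem_flatten.2 ⟨Y, hYm, hc⟩))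
  refine ⟨⟨a, hs.subset ha, b, hs.subset hb, hav.le, hvb, hYq a ha, hYq b hb⟩, ?_⟩
  -- Having been expanded, `W` is contiguous in `m`, so its neighbours lie in different gaps and one
  -- of them leaves `g`.
  have hcW : W.IsChain (γ · ≠ γ ·) := hc.infix (hWm ▸ List.infix_of_mem_flatten hW)
  obtain ⟨x, hx, y, hy, hxy⟩ := exists_ne_of_chain hcW
    (two_le_length_of_ne (hs.subset ha) (hs.subset hb) (by omega))
  by_cases hxg : γ x = g
  · exact ⟨y, hy, fun h => hxy (hxg.trans h.symm)⟩
  · exact ⟨x, hx, hxg⟩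

/-- Sorting the gaps of `γ` by treating the lowest and the highest gap separately. -/
theorem srt_of_gaps {k f : ℕ} {m : List ℕ} (hm : m.Nodup) (hk : CrossFree (k + 1) m)
    {γ : ℕ → ℕ} (hγ : Monotone γ) (hc : m.IsChain (γ · ≠ γ ·)) {g₀ g₁ : ℕ}
    (hg : ∀ a ∈ m, g₀ ≤ γ a ∧ γ a ≤ g₁) (hf : 4 * (k * k) + 4 * k ≤ f)
    (hmid : ∀ q : List ℕ, q.Sublist m → (∀ a ∈ q, γ a ≠ g₀ ∧ γ a ≠ g₁) → Srt f q) :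
    Srt (4 + f) m := by
  have lt_of : ∀ {x y}, γ x < γ y → x < y := fun hxy => by
    by_contra hh
    exact absurd (hγ (not_lt.1 hh)) (not_le.2 hxy)
  -- `srt_of_levelFree` with parameter `2 * k` costs `4 * (k * k) + 4 * k`.
  have hgap : ∀ (g : ℕ) (q : List ℕ), q.Sublist m → (∀ a ∈ q, γ a = g) → Srt f q := by
    intro g q hq hqg
    refine (srt_of_levelFree _ (hm.sublist hq) (levelFree_gap hm hk hγ hc g hq hqg)).mono ?_
    refine le_trans (le_of_eq ?_) hf
    ring
  set bot := m.filter (fun a => decide (γ a = g₀)) with hbot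
  set rest := m.filter (fun a => !decide (γ a = g₀)) with hrest
  set mid := rest.filter (fun a => !decide (γ a = g₁)) with hmd
  set top := rest.filter (fun a => decide (γ a = g₁)) with htop
  have s₁ : Steps 2 m (bot ++ rest) := Steps.separate _ m
  have s₂ : Steps 2 rest (mid ++ top) := by
    have := Steps.separate (fun a => !decide (γ a = g₁)) rest
    simpa using this
  -- Two separations of two steps each account for the summand 4.
  have s := s₁.trans ((Steps.refl 2 bot).append s₂)
  have mb : ∀ a ∈ bot, a ∈ m ∧ γ a = g₀ := by simp [hbot]
  have mm : ∀ a ∈ mid, a ∈ m ∧ γ a ≠ g₀ ∧ γ a ≠ g₁ := by simp [hmd, hrest]; tauto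
  have mt : ∀ a ∈ top, a ∈ m ∧ γ a ≠ g₀ ∧ γ a = g₁ := by simp [htop, hrest]; tauto
  have hr : rest.Sublist m := List.filter_sublist
  refine Srt.of_steps s (Srt.append ?_ (Srt.append ?_ ?_ ?_) ?_)
  · exact hgap g₀ bot List.filter_sublist fun a ha => (mb a ha).2
  · exact hmid mid (List.filter_sublist.trans hr) fun a ha => (mm a ha).2
  · exact hgap g₁ top (List.filter_sublist.trans hr) fun a ha => (mt a ha).2.2
  · intro x hx y hy
    have h₁ := mm x hx
    have h₂ := mt y hy
    have h₃ := hg x h₁.1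
    exact lt_of (by omega)
  · intro x hx y hy
    have h₁ := mb x hx
    rcases List.mem_append.1 hy with hy | hy
    · have h₂ := mm y hy
      have h₃ := hg y h₂.1
      exact lt_of (by omega)
    · have h₂ := mt y hy
      have h₃ := hg y h₂.1
      exact lt_of (by omega)

/-! ### Lists separated by their context -/

/-- The number of elements of `Z` below `a`: the gap of `Z` that contains `a`. -/
def gap (Z : List ℕ) (a : ℕ) : ℕ := Z.countP fun z => decide (z < a)

theorem gap_mono (Z : List ℕ) : Monotone (gap Z) := fun a b hab =>
  List.countP_mono_left fun z _ hz => by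
    simp only [decide_eq_true_eq] at hz ⊢
    omega

theorem gap_append (Z Z' : List ℕ) (a : ℕ) : gap (Z ++ Z') a = gap Z a + gap Z' a :=
  List.countP_append

theorem gap_le (Z : List ℕ) (a : ℕ) : gap Z a ≤ Z.length := List.countP_le_length

theorem exists_lt_of_gap_ne_zero {Z : List ℕ} {a : ℕ} (h : gap Z a ≠ 0) : ∃ z ∈ Z, z < a := by
  simpa [gap, List.countP_eq_zero] using h

theorem exists_ge_of_gap_ne_length {Z : List ℕ} {a : ℕ} (h : gap Z a ≠ Z.length) :
    ∃ z ∈ Z, a ≤ z := by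
  simpa [gap, List.countP_eq_length] using h

theorem not_between_of_gap_eq {Z : List ℕ} {a b z : ℕ} (h : gap Z a = gap Z b) (hz : z ∈ Z) :
    ¬ (a ≤ z ∧ z < b) := by
  rintro ⟨haz, hzb⟩
  have hlt : gap Z a < gap Z b := by
    clear h
    induction Z with
    | nil => simp at hz
    | cons y Z ih =>
      have hm := gap_mono Z (haz.trans hzb.le)
      rcases List.mem_cons.1 hz with rfl | hz
      · have h₁ : ¬ z < a := by omega
        simp only [gap, List.countP_cons, h₁, hzb] at hm ⊢
        simpa using Nat.lt_succ_iff.2 hm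
      · have := ih hz
        simp only [gap, List.countP_cons, decide_eq_true_eq] at this ⊢
        split_ifs <;> omega
  omega

theorem exists_between_of_gap_lt {Z : List ℕ} {a b : ℕ} (h : gap Z a < gap Z b) :
    ∃ z ∈ Z, a ≤ z ∧ z < b := by
  by_contra! hh
  refine absurd h (not_lt.2 (List.countP_mono_left fun z hz hzb => ?_))
  simp only [decide_eq_true_eq] at hzb ⊢
  by_contra hza
  exact absurd (hh z hz (by omega)) (by omega)

/-- The part of a list lying strictly inside the hull of a preceding or succeeding list `Z` has
smaller complexity, if neighbours are separated by `Z`. -/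
theorem crossFree_of_gap {k : ℕ} (hk : 1 ≤ k) {Z m : List ℕ} (hd : Z.Disjoint m)
    (h : CrossFree (k + 1) (Z ++ m) ∨ CrossFree (k + 1) (m ++ Z))
    (hc : m.IsChain (gap Z · ≠ gap Z ·)) {q : List ℕ} (hq : q.Sublist m)
    (hg : ∀ a ∈ q, gap Z a ≠ 0 ∧ gap Z a ≠ Z.length) : CrossFree k q := by
  intro Ys hY h2 hcr
  by_cases hYs : Ys = []
  · subst hYs
    exact hk
  obtain ⟨Ws, hWm, hYW⟩ := exists_expand hYs (hY.trans hq)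
  rw [hYW.length_eq]
  have hsub : ∀ W ∈ Ws, W ⊆ m := fun W hW => hWm ▸ (List.infix_of_mem_flatten hW).subset
  -- An element of `q` in `W` lies inside the hull of `Z`; conversely, neighbours in `W` from
  -- different gaps enclose an element of `Z`.
  have key : ∀ W ∈ Ws, Cross Z W ∧ 2 ≤ W.length ∧ 2 ≤ Z.length := by
    intro W hW
    obtain ⟨Y, hYm, hs⟩ := exists_of_forall₂_right hYW hW
    have hW2 : 2 ≤ W.length := (h2 Y hYm).trans hs.length_le
    have hY0 : Y ≠ [] := by
      rintro rfl
      simpa using h2 _ hYm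
    obtain ⟨y, hy⟩ := List.exists_mem_of_ne_nil Y hY0
    have hyg := hg y (hY.subset (List.mem_flatten.2 ⟨Y, hYm, hy⟩))
    obtain ⟨z, hz, hzy⟩ := exists_lt_of_gap_ne_zero hyg.1
    obtain ⟨z', hz', hzy'⟩ := exists_ge_of_gap_ne_length hyg.2
    have hyW := hs.subset hy
    have hyz' : y ≠ z' := fun e => hd hz' (e ▸ hsub W hW hyW)
    refine ⟨⟨?_, y, hyW, z, hz, z', hz', hzy, by omega⟩, hW2,
      two_le_length_of_ne hz hz' (by omega)⟩
    have hcW : W.IsChain (gap Z · ≠ gap Z ·) := hc.infix (hWm ▸ List.infix_of_mem_flatten hW)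
    obtain ⟨a, ha, b, hb, hab⟩ := exists_ne_of_chain hcW hW2
    rcases lt_or_gt_of_ne hab with hab | hab
    · obtain ⟨x, hx, h₁, h₂⟩ := exists_between_of_gap_lt hab
      have : a ≠ x := fun e => hd hx (e ▸ hsub W hW ha)
      exact ⟨x, hx, a, ha, b, hb, by omega, h₂⟩
    · obtain ⟨x, hx, h₁, h₂⟩ := exists_between_of_gap_lt hab
      have : b ≠ x := fun e => hd hx (e ▸ hsub W hW hb)
      exact ⟨x, hx, b, hb, a, ha, by omega, h₂⟩
  have hWc := pairwise_cross_of_forall₂ hYW hcr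
  obtain ⟨W₀, hW₀⟩ : ∃ W, W ∈ Ws := by
    refine List.exists_mem_of_ne_nil Ws ?_
    rintro rfl
    exact hYs (List.forall₂_nil_right_iff.1 hYW)
  have hZ2 := (key W₀ hW₀).2.2
  rcases h with h | h
  · have := h (Z :: Ws) (by simp [hWm]) (by simpa [hZ2] using fun W hW => (key W hW).2.1)
      (List.pairwise_cons.2 ⟨fun W hW => (key W hW).1, hWc⟩)
    simpa using this
  · have := h (Ws ++ [Z]) (by simp [hWm])
      (by simpa [hZ2, or_imp, forall_and] using fun W hW => (key W hW).2.1)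
      (List.pairwise_append.2 ⟨hWc, by simp, fun W hW Z' hZ' => by
        rw [List.mem_singleton.1 hZ']
        exact (key W hW).1.symm⟩)
    simpa using this

/-- Sorting a list whose neighbours are separated by elements to its left or right. -/
theorem srt_of_context {k f : ℕ} (hk : 1 ≤ k) (ih : ∀ q : List ℕ, q.Nodup → CrossFree k q → Srt f q)
    (hf : 4 * (k * k) + 4 * k ≤ f) {ZL m ZR : List ℕ} (hn : (ZL ++ m ++ ZR).Nodup)
    (hcf : CrossFree (k + 1) (ZL ++ m ++ ZR))
    (hc : m.IsChain (gap (ZL ++ ZR) · ≠ gap (ZL ++ ZR) ·)) :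
    Srt (4 + f + 4 * k) m := by
  obtain ⟨hnL, hnR, hdR⟩ := List.nodup_append'.1 hn
  obtain ⟨-, hnm, hdL⟩ := List.nodup_append'.1 hnL
  have hcL : CrossFree (k + 1) (ZL ++ m) := hcf.sublist (List.sublist_append_left _ _)
  have hcR : CrossFree (k + 1) (m ++ ZR) :=
    hcf.sublist ((List.sublist_append_right ZL m).append (.refl ZR))
  have hcm : CrossFree (k + 1) m := hcL.sublist (List.sublist_append_right _ _)
  -- `crossFree_of_gap` needs a context on one side only. Block representatives are separated by
  -- `ZL`, and neighbours inside a block must be separated by `ZR`.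
  obtain ⟨Ns, hNs⟩ := exists_isBlocks (gap ZL) m
  have s₁ : Srt (4 + f) (Ns.map lmin) := by
    refine srt_of_gaps (hnm.sublist hNs.lmin_sublist) (hcm.sublist hNs.lmin_sublist) (gap_mono ZL)
      hNs.lmin_chain (fun a _ => ⟨Nat.zero_le _, gap_le ZL a⟩) hf fun q hq hqg => ?_
    refine ih q (hnm.sublist (hq.trans hNs.lmin_sublist)) (crossFree_of_gap hk ?_
      (Or.inl (hcL.sublist ((List.Sublist.refl ZL).append hNs.lmin_sublist))) hNs.lmin_chain hq hqg)
    exact fun x hx hxm => hdL hx (hNs.lmin_sublist.subset hxm)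
  obtain ⟨t, ht, hts⟩ := s₁
  obtain ⟨Ns', hst, rfl⟩ := ht.lift_map
  have s₂ : ∀ N, ∃ S, N ∈ Ns → Steps (4 + f) N S ∧ S.Pairwise (· < ·) := by
    intro N
    by_cases hN : N ∈ Ns
    swap
    · exact ⟨[], fun h => absurd h hN⟩
    have hNm := hNs.isInfix hN
    have hNc : N.IsChain (gap ZR · ≠ gap ZR ·) := by
      refine (hc.infix hNm).imp_of_mem_imp fun a b ha hb hab => ?_
      rw [gap_append, gap_append, hNs.const N hN a ha b hb] at hab
      exact fun e => hab (by rw [e])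
    obtain ⟨S, hS⟩ : Srt (4 + f) N := by
      refine srt_of_gaps (hnm.sublist hNm.sublist) (hcm.sublist hNm.sublist) (gap_mono ZR)
        hNc (fun a _ => ⟨Nat.zero_le _, gap_le ZR a⟩) hf fun q hq hqg => ?_
      refine ih q (hnm.sublist (hq.trans hNm.sublist)) (crossFree_of_gap hk ?_
        (Or.inr (hcR.sublist (hNm.sublist.append (.refl ZR)))) hNc hq hqg)
      exact fun x hx hxm => hdR (List.mem_append_right _ (hNm.subset hxm)) hx
    exact ⟨S, fun _ => hS⟩
  choose S hS using s₂
  have memN : ∀ {N}, N ∈ Ns' ↔ N ∈ Ns := hst.perm.mem_iff.symm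
  have memS : ∀ {N}, N ∈ Ns → ∀ {a}, a ∈ S N ↔ a ∈ N :=
    fun hN _ => (hS _ hN).1.perm.mem_iff.symm
  -- Blocks and their contents are sorted in the same steps; only a merge of cost `4 * k` remains.
  have s₃ : Steps (4 + f) m (Ns'.flatMap S) := by
    have := hst.flatMap (F := id) fun N hN => (hS N hN).1
    rwa [List.flatMap_id, hNs.flatten] at this
  have hcl := hNs.cliqueLE (gap_mono ZL) hnm hcm
  refine Srt.of_steps s₃ (srt_of_cliqueLE (2 * k + 1) Ns' S (hst.perm.nodup_iff.1 (hNs.nodup hnm))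
    ?_ (fun N hN => (hS N (memN.1 hN)).2) (s₃.perm.nodup_iff.1 hnm) ?_ ?_ |>.mono (by omega))
  · intro N hN e
    have := (memS (memN.1 hN)).2 (lmin_mem (hNs.ne_nil N (memN.1 hN)))
    simp [e] at this
  · refine (List.pairwise_map.1 hts).imp_of_mem fun {N N'} hN hN' h => ?_
    exact ⟨_, (memS (memN.1 hN)).2 (lmin_mem (hNs.ne_nil N (memN.1 hN))), _,
      (memS (memN.1 hN')).2 (lmin_mem (hNs.ne_nil N' (memN.1 hN'))), h⟩
  · intro v s hs hsv
    refine hcl v s hs fun N hN => ?_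
    obtain ⟨hN', hv⟩ := hsv N hN
    exact ⟨memN.1 hN', hv.mono fun a ha => (memS (memN.1 hN')).1 ha⟩

/-! ### Presortings -/

/-- `Bs` is an arrangement of `p` (by `a` separable rearrangements) into blocks that increase from
block to block, lie each in one gap of `γ`, and can each be sorted in `b` steps. -/
structure IsPresorting (a b : ℕ) (γ : ℕ → ℕ) (p : List ℕ) (Bs : List (List ℕ)) : Prop where
  steps : Steps a p Bs.flatten
  ne_nil : ∀ B ∈ Bs, B ≠ []
  lt : Bs.Pairwise fun B C => ∀ x ∈ B, ∀ y ∈ C, x < y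
  const : ∀ B ∈ Bs, ∀ x ∈ B, ∀ y ∈ B, γ x = γ y
  srt : ∀ B ∈ Bs, Srt b B

theorem pairwise_lt_of_chain {ι : Type*} {Gs : List ι} {val : ι → List ℕ}
    (hne : ∀ G ∈ Gs, val G ≠ [])
    (hc : Gs.IsChain fun G H => ∀ x ∈ val G, ∀ y ∈ val H, x < y) :
    Gs.Pairwise fun G H => ∀ x ∈ val G, ∀ y ∈ val H, x < y := by
  induction Gs with
  | nil => exact .nil
  | cons G Gs ih =>
    have ih' := ih (fun H hH => hne H (List.mem_cons_of_mem _ hH)) hc.tail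
    refine List.pairwise_cons.2 ⟨?_, ih'⟩
    match Gs, hc, ih', hne with
    | [], _, _, _ => simp
    | H :: Hs, hc, ih', hne =>
      have hGH := (List.isChain_cons_cons.1 hc).1
      intro K hK x hx y hy
      rcases List.mem_cons.1 hK with rfl | hK
      · exact hGH x hx y hy
      · obtain ⟨z, hz⟩ := List.exists_mem_of_ne_nil _ (hne H (by simp))
        exact (hGH x hx z hz).trans ((List.pairwise_cons.1 ih').1 K hK z hz y hy)

theorem isChain_and_pairwise {ι : Type*} {R S : ι → ι → Prop} {l : List ι} (h : l.IsChain R)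
    (h' : l.Pairwise S) : l.IsChain fun a b => R a b ∧ S a b := by
  have hs := h'.isChain
  rw [List.isChain_iff_forall_rel_of_append_cons_cons] at h hs ⊢
  exact fun a b l₁ l₂ e => ⟨h e, hs e⟩

theorem flatten_map_flatten {α β : Type*} (Gs : List (List α)) (f : α → List β) :
    (Gs.map fun G => G.flatMap f).flatten = Gs.flatten.flatMap f := by
  induction Gs with
  | nil => rfl
  | cons G Gs ih => simp [ih]

theorem flatten_flatMap {α β : Type*} (G : List α) (f : α → List (List β)) :
    (G.flatMap f).flatten = G.flatMap fun a => (f a).flatten := by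
  induction G with
  | nil => rfl
  | cons a G ih => simp [ih]

/-- Keeps the minimum of a block visible among the minima of its parts, which gives the consistent
order required by `srt_of_cliqueLE`. -/
theorem lmin_mem_map {J : List ℕ} {Ks : List (List ℕ)} (hJ : J ≠ [])
    (h : ∀ a, a ∈ Ks.flatten ↔ a ∈ J) : lmin J ∈ Ks.map lmin := by
  obtain ⟨K, hK, hm⟩ := List.mem_flatten.1 ((h _).2 (lmin_mem hJ))
  refine List.mem_map.2 ⟨K, hK, le_antisymm (lmin_le hm) (lmin_le ?_)⟩
  exact (h _).1 (List.mem_flatten.2 ⟨K, hK, lmin_mem (List.ne_nil_of_mem hm)⟩)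

/-- If no element of `B` lies in the hull of `A`, comparing minima compares all elements. -/
theorem lt_of_lmin_lt {A B : List ℕ} (h : ∀ x ∈ A, ∀ y ∈ A, ∀ z ∈ B, ¬ (x ≤ z ∧ z < y))
    (hd : A.Disjoint B) (hm : lmin A < lmin B) : ∀ x ∈ A, ∀ y ∈ B, x < y := by
  intro x hx y hy
  have h₁ := h _ (lmin_mem (List.ne_nil_of_mem hx)) x hx y hy
  have h₂ := lmin_le hy
  have h₃ : x ≠ y := fun e => hd hx (e ▸ hy)
  omega

/-- Splitting `p` by `γ` and each part by the rest of `p` yields a presorting of `p`, if the parts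
of the second level have presortings. -/
theorem exists_presorting_of_parts {k r : ℕ} {p : List ℕ} (hp : p.Nodup)
    (hcf : CrossFree (k + 1) p) {γ : ℕ → ℕ} (hγ : Monotone γ)
    {Js : List (List ℕ)} (hJs : IsBlocks γ p Js) (hr : Srt r (Js.map lmin))
    {c : List ℕ → ℕ → ℕ} {Ks : List ℕ → List (List ℕ)}
    (hc : ∀ J ∈ Js, Monotone (c J))
    (hcJ : ∀ J ∈ Js, ∀ x y, c J x = c J y → ∀ z ∈ p, z ∉ J → ¬ (x ≤ z ∧ z < y))
    (hKs : ∀ J ∈ Js, IsBlocks (c J) J (Ks J)) (hrK : ∀ J ∈ Js, Srt r ((Ks J).map lmin))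
    {d : List ℕ × List ℕ → ℕ → ℕ} {Bs : List ℕ × List ℕ → List (List ℕ)}
    (hd : ∀ J ∈ Js, ∀ K ∈ Ks J, ∀ x y, d (J, K) x = d (J, K) y → ∀ z ∈ J, z ∉ K →
      ¬ (x ≤ z ∧ z < y))
    (hBs : ∀ J ∈ Js, ∀ K ∈ Ks J, IsPresorting (r + 4 * k) (4 * k) (d (J, K)) K (Bs (J, K))) :
    ∃ Bs', IsPresorting (r + 4 * k) (4 * k) γ p Bs' := by
  have hJp : ∀ {J}, J ∈ Js → J.Sublist p := fun hJ => (hJs.isInfix hJ).sublist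
  -- the parts sorted by their minima, at both levels
  obtain ⟨t, ht, hts⟩ := hr
  obtain ⟨Js', hJJ, rfl⟩ := ht.lift_map
  have memJ : ∀ {J}, J ∈ Js' ↔ J ∈ Js := hJJ.perm.mem_iff.symm
  have : ∀ J, ∃ Ks', J ∈ Js → Steps r (Ks J) Ks' ∧ (Ks'.map lmin).Pairwise (· < ·) := by
    intro J
    by_cases hJ : J ∈ Js
    · obtain ⟨t, ht, hts⟩ := hrK J hJ
      obtain ⟨Ks', h, rfl⟩ := ht.lift_map
      exact ⟨Ks', fun _ => ⟨h, hts⟩⟩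
    · exact ⟨[], fun h => absurd h hJ⟩
  choose Ks' hKs' using this
  have s₁ : Steps r (Js.flatMap fun J => (Ks J).map (Prod.mk J))
      (Js'.flatMap fun J => (Ks' J).map (Prod.mk J)) :=
    hJJ.flatMap fun J hJ => (hKs' J hJ).1.map _
  set Ls := Js.flatMap fun J => (Ks J).map (Prod.mk J) with hLs
  set Ls₁ := Js'.flatMap fun J => (Ks' J).map (Prod.mk J) with hLs₁
  have memL : ∀ {j}, j ∈ Ls → j.1 ∈ Js ∧ j.2 ∈ Ks j.1 := by
    intro j hj
    obtain ⟨J, hJ, hj⟩ := List.mem_flatMap.1 hj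
    obtain ⟨K, hK, rfl⟩ := List.mem_map.1 hj
    exact ⟨hJ, hK⟩
  have hLp : Ls.flatMap Prod.snd = p := by
    have : ∀ J ∈ Js, (Ks J).flatten = id J := fun J hJ => (hKs J hJ).flatten
    rw [hLs, List.flatMap_assoc]
    simp only [List.flatMap_map]
    rw [List.flatMap_congr fun J hJ => (by
      rw [← this J hJ, ← List.flatMap_id]; rfl :
        ((Ks J).flatMap fun K => (J, K).2) = id J), List.flatMap_id, hJs.flatten]
  have neL : ∀ {j}, j ∈ Ls → j.2 ≠ [] := fun hj =>
    (hKs _ (memL hj).1).ne_nil _ (memL hj).2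
  have subL : ∀ {j}, j ∈ Ls → j.2 ⊆ j.1 := fun hj =>
    ((hKs _ (memL hj).1).isInfix (memL hj).2).subset
  -- merging the first level
  have hmin : ∀ J ∈ Js, lmin J ∈ (Ks' J).map lmin := fun J hJ =>
    lmin_mem_map (hJs.ne_nil J hJ) fun a =>
      (hKs' J hJ).1.perm.flatten.mem_iff.symm.trans (by rw [(hKs J hJ).flatten])
  have s₂ : Srt (4 * k) (Ls₁.map fun j => lmin j.2) := by
    have e : Ls₁.map (fun j => lmin j.2) = Js'.flatMap fun J => (Ks' J).map lmin := by
      rw [hLs₁, List.map_flatMap]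
      simp only [List.map_map]
      rfl
    have hnd : (Ls₁.map fun j => lmin j.2).Nodup := by
      rw [← (s₁.perm.map _).nodup_iff]
      have := map_lmin_sublist (Js := Ls.map Prod.snd) (by
        intro K hK
        obtain ⟨j, hj, rfl⟩ := List.mem_map.1 hK
        exact neL hj)
      rw [← List.flatMap_def, hLp, List.map_map] at this
      exact hp.sublist this
    rw [e] at hnd ⊢
    refine (srt_of_cliqueLE (2 * k + 1) Js' _ (hJJ.perm.nodup_iff.1 (hJs.nodup hp)) ?_
      (fun J hJ => (hKs' J (memJ.1 hJ)).2) hnd ?_ ?_).mono (by omega)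
    · intro J hJ
      exact List.ne_nil_of_mem (hmin J (memJ.1 hJ))
    · refine (List.pairwise_map.1 hts).imp_of_mem fun {J J'} hJ hJ' h => ?_
      exact ⟨_, hmin J (memJ.1 hJ), _, hmin J' (memJ.1 hJ'), h⟩
    · intro v s hs hsv
      refine hJs.cliqueLE hγ hp hcf v s hs fun J hJ => ?_
      obtain ⟨hJ', hv⟩ := hsv J hJ
      refine ⟨memJ.1 hJ', hv.mono fun a ha => ?_⟩
      obtain ⟨K, hK, rfl⟩ := List.mem_map.1 ha
      have hB := hKs J (memJ.1 hJ')
      have hK := (hKs' J (memJ.1 hJ')).1.perm.mem_iff.2 hK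
      exact (hB.isInfix hK).subset (lmin_mem (hB.ne_nil K hK))
  obtain ⟨t, ht, hts₂⟩ := s₂
  obtain ⟨Ls₂, hL₂, rfl⟩ := ht.lift_map
  have s₃ : Steps (r + 4 * k) Ls Ls₂ := s₁.trans hL₂
  have memL₂ : ∀ {j}, j ∈ Ls₂ ↔ j ∈ Ls := s₃.perm.mem_iff.symm
  have hB : ∀ {j}, j ∈ Ls → IsPresorting (r + 4 * k) (4 * k) (d j) j.2 (Bs j) :=
    fun {j} hj => hBs j.1 (memL hj).1 j.2 (memL hj).2
  -- The recursive presortings run during these same steps, so the depth of the recursion costs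
  -- nothing.
  have s₄ : Steps (r + 4 * k) p (Ls₂.flatMap fun j => (Bs j).flatten) := by
    have := s₃.flatMap (F := Prod.snd) fun j hj => (hB hj).steps
    rwa [hLp] at this
  have nd₂ : Ls₂.Nodup := List.Nodup.of_map _ (hts₂.imp ne_of_lt)
  have lt₂ := List.pairwise_map.1 hts₂
  have memB : ∀ {j}, j ∈ Ls → ∀ {a}, a ∈ (Bs j).flatten ↔ a ∈ j.2 :=
    fun hj _ => (hB hj).steps.perm.mem_iff.symm
  -- runs of parts of the second level within the same part of the first level
  obtain ⟨Gs, hGs⟩ := exists_isBlocks (Prod.fst : List ℕ × List ℕ → List ℕ) Ls₂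
  have memG : ∀ {G}, G ∈ Gs → ∀ {j}, j ∈ G → j ∈ Ls := fun hG _ hj =>
    memL₂.1 (hGs.flatten ▸ List.mem_flatten.2 ⟨_, hG, hj⟩)
  have memv : ∀ {G}, G ∈ Gs → ∀ {a}, a ∈ G.flatMap (fun j => (Bs j).flatten) →
      ∃ j ∈ G, a ∈ j.2 := by
    intro G hG a ha
    obtain ⟨j, hj, ha⟩ := List.mem_flatMap.1 ha
    exact ⟨j, hj, (memB (memG hG hj)).1 ha⟩
  have ltG : Gs.Pairwise fun G H => ∀ i ∈ G, ∀ j ∈ H, lmin i.2 < lmin j.2 := by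
    have := hGs.flatten.symm ▸ lt₂
    exact (List.pairwise_flatten.1 this).2
  have neG : ∀ G ∈ Gs, G.flatMap (fun j => (Bs j).flatten) ≠ [] := by
    intro G hG
    obtain ⟨j, hj⟩ := List.exists_mem_of_ne_nil G (hGs.ne_nil G hG)
    obtain ⟨a, ha⟩ := List.exists_mem_of_ne_nil _ (neL (memG hG hj))
    exact List.ne_nil_of_mem (List.mem_flatMap.2 ⟨j, hj, (memB (memG hG hj)).2 ha⟩)
  refine ⟨Gs.map fun G => G.flatMap fun j => (Bs j).flatten, ?_, ?_, ?_, ?_, ?_⟩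
  · rwa [flatten_map_flatten, hGs.flatten]
  · intro B hB'
    obtain ⟨G, hG, rfl⟩ := List.mem_map.1 hB'
    exact neG G hG
  · rw [List.pairwise_map]
    -- A part of `J` lies in one gap of the rest of `p`, so no value of another `J'` enters its
    -- hull, and comparing minima suffices.
    refine pairwise_lt_of_chain neG ((isChain_and_pairwise hGs.chain ltG).imp_of_mem_imp ?_)
    rintro G H hG hH ⟨hne, hlt⟩ x hx y hy
    obtain ⟨i, hi, hx⟩ := memv hG hx
    obtain ⟨j, hj, hy⟩ := memv hH hy
    have hi' := memG hG hi
    have hj' := memG hH hj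
    have hdj := hJs.disjoint hp (memL hi').1 (memL hj').1 (hne i hi j hj)
    refine lt_of_lmin_lt (fun x hx y hy z hz => ?_)
      (fun a ha hb => hdj (subL hi' ha) (subL hj' hb)) (hlt i hi j hj) x hx y hy
    exact hcJ i.1 (memL hi').1 x y ((hKs _ (memL hi').1).const _ (memL hi').2 x hx y hy) z
      ((hJp (memL hj').1).subset (subL hj' hz)) fun h => hdj h (subL hj' hz)
  · intro B hB' x hx y hy
    obtain ⟨G, hG, rfl⟩ := List.mem_map.1 hB'
    obtain ⟨i, hi, hx⟩ := memv hG hx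
    obtain ⟨j, hj, hy⟩ := memv hG hy
    have e := hGs.const G hG i hi j hj
    exact hJs.const i.1 (memL (memG hG hi)).1 x (subL (memG hG hi) hx) y
      (e ▸ subL (memG hG hj) hy)
  · intro B hB'
    obtain ⟨G, hG, rfl⟩ := List.mem_map.1 hB'
    obtain ⟨j₀, hj₀⟩ := List.exists_mem_of_ne_nil G (hGs.ne_nil G hG)
    have hJ := (memL (memG hG hj₀)).1
    generalize hJ₀ : j₀.1 = J at hJ
    have hfst : ∀ {j}, j ∈ G → j.1 = J := fun hj => (hGs.const G hG _ hj _ hj₀).trans hJ₀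
    have hKJ : ∀ {j}, j ∈ G → j.2 ∈ Ks J := fun hj => hfst hj ▸ (memL (memG hG hj)).2
    have hnG : G.Nodup := nd₂.sublist (hGs.isInfix hG).sublist
    have hlG : G.Pairwise fun i j => lmin i.2 < lmin j.2 := lt₂.sublist (hGs.isInfix hG).sublist
    have hinj : ∀ {i j}, i ∈ G → j ∈ G → i ≠ j → i.2 ≠ j.2 := fun hi hj hij e =>
      hij (Prod.ext ((hfst hi).trans (hfst hj).symm) e)
    have hmB : ∀ {j}, j ∈ G → lmin j.2 ∈ (Bs j).map lmin := fun hj =>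
      lmin_mem_map (neL (memG hG hj)) fun _ => memB (memG hG hj)
    have hsB : ∀ {j}, j ∈ G → ∀ B ∈ Bs j, B ⊆ j.2 := fun hj B hB a ha =>
      (memB (memG hG hj)).1 (List.mem_flatten.2 ⟨B, hB, ha⟩)
    -- All parts in a run come from one `J`, so the overlap bound for `Ks J` merges the minima. The
    -- contents of the blocks are sorted meanwhile, again in `4 * k` steps.
    have m₁ : Srt (4 * k) ((G.flatMap Bs).map lmin) := by
      rw [List.map_flatMap]
      refine (srt_of_cliqueLE (2 * k + 1) G _ hnG (fun j hj => List.ne_nil_of_mem (hmB hj)) ?_ ?_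
        ?_ ?_).mono (by omega)
      · intro j hj
        rw [List.pairwise_map]
        have h := hB (memG hG hj)
        exact h.lt.imp_of_mem fun {B C} hB hC hBC =>
          hBC _ (lmin_mem (h.ne_nil B hB)) _ (lmin_mem (h.ne_nil C hC))
      · rw [← List.map_flatMap]
        refine List.Nodup.sublist (map_lmin_sublist fun B hBm => ?_) ?_
        · obtain ⟨j, hj, hBj⟩ := List.mem_flatMap.1 hBm
          exact (hB (memG hG hj)).ne_nil B hBj
        · have h₁ : (Ls₂.flatMap fun j => (Bs j).flatten).Nodup := s₄.perm.nodup_iff.1 hp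
          have h₂ := h₁.sublist (List.Sublist.flatMap (hGs.isInfix hG).sublist _)
          rwa [flatten_flatMap]
      · exact hlG.imp_of_mem fun {i j} hi hj h => ⟨_, hmB hi, _, hmB hj, h⟩
      · intro v s hs hsv
        have hK := hKs J hJ
        have := hK.cliqueLE (hc J hJ) (hp.sublist (hJp hJ)) (hcf.sublist (hJp hJ)) v
          (s.map Prod.snd) ?_ ?_
        · simpa using this
        · refine hs.map_on fun i hi j hj e => ?_
          by_contra hij
          exact hinj (hsv i hi).1 (hsv j hj).1 hij e
        · intro K hKs
          obtain ⟨j, hj, rfl⟩ := List.mem_map.1 hKs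
          obtain ⟨hjG, hv⟩ := hsv j hj
          refine ⟨hKJ hjG, hv.mono fun a ha => ?_⟩
          obtain ⟨B, hBj, rfl⟩ := List.mem_map.1 ha
          exact hsB hjG B hBj (lmin_mem ((hB (memG hG hjG)).ne_nil B hBj))
    obtain ⟨t, ht, hts'⟩ := m₁
    obtain ⟨Cs, hCs, rfl⟩ := ht.lift_map
    have : ∀ B, ∃ S, B ∈ G.flatMap Bs → Steps (4 * k) B S ∧ S.Pairwise (· < ·) := by
      intro B
      by_cases h : B ∈ G.flatMap Bs
      · obtain ⟨j, hj, hBj⟩ := List.mem_flatMap.1 h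
        obtain ⟨S, hS⟩ := (hB (memG hG hj)).srt B hBj
        exact ⟨S, fun _ => hS⟩
      · exact ⟨[], fun h' => absurd h' h⟩
    choose S hS using this
    have memC : ∀ {B}, B ∈ Cs ↔ B ∈ G.flatMap Bs := hCs.perm.mem_iff.symm
    refine ⟨Cs.flatMap S, ?_, List.pairwise_flatMap.2 ⟨fun B hB' => (hS B (memC.1 hB')).2, ?_⟩⟩
    · have := hCs.flatMap (F := id) fun B hB' => (hS B hB').1
      rwa [List.flatMap_id, flatten_flatMap] at this
    · refine (List.pairwise_map.1 hts').imp_of_mem fun {B C} hBm hCm hlt x hx y hy => ?_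
      rw [memC] at hBm hCm
      rw [← (hS B hBm).1.perm.mem_iff] at hx
      rw [← (hS C hCm).1.perm.mem_iff] at hy
      obtain ⟨i, hi, hBi⟩ := List.mem_flatMap.1 hBm
      obtain ⟨j, hj, hCj⟩ := List.mem_flatMap.1 hCm
      by_cases hij : i = j
      · subst hij
        have h := hB (memG hG hi)
        have hor : (Bs i).Pairwise fun B C => (∀ x ∈ B, ∀ y ∈ C, x < y) ∨ ∀ x ∈ C, ∀ y ∈ B, x < y :=
          h.lt.imp Or.inl
        have : Std.Symm fun B C : List ℕ =>
            (∀ x ∈ B, ∀ y ∈ C, x < y) ∨ ∀ x ∈ C, ∀ y ∈ B, x < y := ⟨fun _ _ h => h.symm⟩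
        rcases hor.forall hBi hCj (fun e => by simp [e] at hlt) with h' | h'
        · exact h' x hx y hy
        · have := h' _ (lmin_mem (h.ne_nil C hCj)) _ (lmin_mem (h.ne_nil B hBi))
          omega
      -- `B` lies in one gap of the rest of `J`, so minima decide once more.
      · have hdj := (hKs J hJ).disjoint (hp.sublist (hJp hJ)) (hKJ hi) (hKJ hj) (hinj hi hj hij)
        refine lt_of_lmin_lt (fun x hx y hy z hz => ?_)
          (fun a ha hb => hdj (hsB hi B hBi ha) (hsB hj C hCj hb)) hlt x hx y hy
        have hz' := hsB hj C hCj hz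
        exact hd i.1 (memL (memG hG hi)).1 i.2 (memL (memG hG hi)).2 x y
          ((hB (memG hG hi)).const B hBi x hx y hy) z
          ((hfst hi).symm ▸ (hfst hj ▸ subL (memG hG hj) hz')) fun h => hdj h hz'

theorem exists_split_of_mem {Js : List (List ℕ)} {J : List ℕ} (h : J ∈ Js) :
    ∃ ZL ZR, Js.flatten = ZL ++ J ++ ZR := by
  obtain ⟨s, t, rfl⟩ := List.append_of_mem h
  exact ⟨s.flatten, t.flatten, by simp⟩

theorem length_le_one_of_chain {γ : ℕ → ℕ} {m : List ℕ} (hc : m.IsChain (γ · ≠ γ ·))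
    (h : ∀ a ∈ m, ∀ b ∈ m, γ a = γ b) : m.length ≤ 1 := by
  by_contra! hlt
  obtain ⟨x, hx, y, hy, hxy⟩ := exists_ne_of_chain hc hlt
  exact hxy (h x hx y hy)

/-- Recursion on length: each block `J` of `γ` is cut by the gaps of the rest of `p`, and each
resulting part `K` is presorted with respect to the gaps of the rest of `J`. Representatives of the
`J` are sorted by `hgood`, those of the `K` by `hR`, which also supplies `hgood` for the recursive
call. -/
theorem exists_presorting {k r : ℕ} (hr : 4 + (4 * (k * k) + 4 * k) ≤ r)
    (hR : ∀ ZL m ZR : List ℕ, (ZL ++ m ++ ZR).Nodup → CrossFree (k + 1) (ZL ++ m ++ ZR) →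
      m.IsChain (gap (ZL ++ ZR) · ≠ gap (ZL ++ ZR) ·) → Srt r m)
    {p : List ℕ} (hp : p.Nodup) (hcf : CrossFree (k + 1) p) {γ : ℕ → ℕ} (hγ : Monotone γ)
    (hgood : ∀ m : List ℕ, m.Sublist p → m.IsChain (γ · ≠ γ ·) → Srt r m) :
    ∃ Bs, IsPresorting (r + 4 * k) (4 * k) γ p Bs := by
  induction hn : p.length using Nat.strong_induction_on generalizing p γ with
  | _ n ih =>
    have core : ∀ {γ : ℕ → ℕ}, Monotone γ →
        (∀ m : List ℕ, m.Sublist p → m.IsChain (γ · ≠ γ ·) → Srt r m) →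
        (∃ a ∈ p, ∃ b ∈ p, γ a ≠ γ b) → ∃ Bs, IsPresorting (r + 4 * k) (4 * k) γ p Bs := by
      intro γ hγ hgood hne
      obtain ⟨Js, hJs⟩ := exists_isBlocks γ p
      have hZ : ∀ J, ∃ ZL ZR, J ∈ Js → p = ZL ++ J ++ ZR := by
        intro J
        by_cases hJ : J ∈ Js
        · obtain ⟨ZL, ZR, h⟩ := exists_split_of_mem hJ
          exact ⟨ZL, ZR, fun _ => hJs.flatten ▸ h⟩
        · exact ⟨[], [], fun h => absurd h hJ⟩
      choose ZL ZR hZ using hZ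
      have hc : ∀ J, ∃ Ks, IsBlocks (gap (ZL J ++ ZR J)) J Ks := fun J => exists_isBlocks _ J
      choose Ks hKs using hc
      have hz : ∀ j : List ℕ × List ℕ, ∃ zl zr, j.2 ∈ Ks j.1 → j.1 = zl ++ j.2 ++ zr := by
        rintro ⟨J, K⟩
        by_cases hK : K ∈ Ks J
        · obtain ⟨zl, zr, h⟩ := exists_split_of_mem hK
          exact ⟨zl, zr, fun _ => (hKs J).flatten.symm.trans h⟩
        · exact ⟨[], [], fun h => absurd h hK⟩
      choose zl zr hz using hz
      have hJp : ∀ {J}, J ∈ Js → J.Sublist p := fun hJ => (hJs.isInfix hJ).sublist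
      have hB : ∀ j : List ℕ × List ℕ, ∃ Bs, j.1 ∈ Js → j.2 ∈ Ks j.1 →
          IsPresorting (r + 4 * k) (4 * k) (gap (zl j ++ zr j)) j.2 Bs := by
        rintro ⟨J, K⟩
        by_cases hJ : J ∈ Js
        swap
        · exact ⟨[], fun h => absurd h hJ⟩
        by_cases hK : K ∈ Ks J
        swap
        · exact ⟨[], fun _ h => absurd h hK⟩
        have e := hz (J, K) hK
        dsimp only at e
        have hKJ : K.Sublist J := ((hKs J).isInfix hK).sublist
        have hlt : K.length < n := by
          refine lt_of_le_of_lt hKJ.length_le (lt_of_le_of_ne (hn ▸ (hJp hJ).length_le) fun h => ?_)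
          obtain ⟨a, ha, b, hb, hab⟩ := hne
          have hJe : J = p := (hJp hJ).eq_of_length (h.trans hn.symm)
          exact hab (hJs.const J hJ a (hJe ▸ ha) b (hJe ▸ hb))
        have hnJ := hp.sublist (hJp hJ)
        have hcJ := hcf.sublist (hJp hJ)
        obtain ⟨Bs, hBs⟩ := ih K.length hlt (hnJ.sublist hKJ) (hcJ.sublist hKJ)
          (gap_mono (zl (J, K) ++ zr (J, K))) (fun m hm hmc => by
            have hs : (zl (J, K) ++ m ++ zr (J, K)).Sublist J := by
              have := ((List.Sublist.refl (zl (J, K))).append hm).append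
                (List.Sublist.refl (zr (J, K)))
              rwa [← e] at this
            exact hR _ m _ (hnJ.sublist hs) (hcJ.sublist hs) hmc) rfl
        exact ⟨Bs, fun _ _ => hBs⟩
      choose Bs hB using hB
      refine exists_presorting_of_parts hp hcf hγ hJs (hgood _ hJs.lmin_sublist hJs.lmin_chain)
        (c := fun J => gap (ZL J ++ ZR J)) (Ks := Ks) (fun J _ => gap_mono _) ?_
        (fun J _ => hKs J) ?_ (d := fun j => gap (zl j ++ zr j)) (Bs := Bs) ?_
        (fun J hJ K hK => hB (J, K) hJ hK)
      · intro J hJ x y hxy z hz hzJ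
        rw [hZ J hJ] at hz
        refine not_between_of_gap_eq hxy ?_
        simpa [hzJ] using hz
      · intro J hJ
        have hs : (ZL J ++ (Ks J).map lmin ++ ZR J).Sublist p := by
          have := ((List.Sublist.refl (ZL J)).append (hKs J).lmin_sublist).append
            (List.Sublist.refl (ZR J))
          rwa [← hZ J hJ] at this
        exact hR _ _ _ (hp.sublist hs) (hcf.sublist hs) (hKs J).lmin_chain
      · intro J hJ K hK x y hxy z hz' hzK
        have e := hz (J, K) hK
        dsimp only at e
        rw [e] at hz'
        refine not_between_of_gap_eq hxy ?_
        simpa [hzK] using hz'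
    by_cases hne : ∃ a ∈ p, ∃ b ∈ p, γ a ≠ γ b
    · exact core hγ hgood hne
    push Not at hne
    by_cases hlen : p.length ≤ 1
    · by_cases hp0 : p = []
      · subst hp0
        exact ⟨[], Steps.refl _ _, by simp, .nil, by simp, by simp⟩
      · exact ⟨[p], by simpa using Steps.refl _ p, by simpa using hp0, by simp, by simpa using hne,
          by simpa using Srt.of_length_le_one _ hlen⟩
    obtain ⟨a, ha, b, hb, hab⟩ : ∃ a ∈ p, ∃ b ∈ p, a < b := by
      by_contra! h
      exact hlen (length_le_one_of_nodup hp fun a ha b hb =>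
        le_antisymm (h b hb a ha) (h a ha b hb))
    -- A constant `γ` gives no progress, so the list is cut at the value `b` instead. With only two
    -- gaps the middle part in `srt_of_gaps` is empty.
    have hγ' : Monotone fun x : ℕ => if x < b then 0 else 1 := by
      intro x y hxy
      dsimp only
      split_ifs <;> omega
    obtain ⟨Bs, hBs⟩ := core hγ' (fun m hm hc => by
      refine (srt_of_gaps (hp.sublist hm) (hcf.sublist hm) hγ' hc (g₀ := 0) (g₁ := 1) ?_ le_rfl
        ?_).mono hr
      · intro x _
        split_ifs <;> omega
      · intro q _ hq
        match q, hq with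
        | [], _ => exact Srt.of_pairwise _ .nil
        | x :: q, hq =>
          have := hq x (by simp)
          split_ifs at this <;> omega) ⟨a, ha, b, hb, by simp [hab]⟩
    have hm : ∀ B ∈ Bs, ∀ x ∈ B, x ∈ p := fun B hB x hx =>
      hBs.steps.perm.mem_iff.2 (List.mem_flatten.2 ⟨B, hB, hx⟩)
    exact ⟨Bs, hBs.steps, hBs.ne_nil, hBs.lt,
      fun B hB x hx y hy => hne x (hm B hB x hx) y (hm B hB y hy), hBs.srt⟩

/-! ### The quadratic bound -/

/-- A list without `k + 1` pairwise crossing intervals of positions can be sorted by boundedly many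
separable rearrangements. -/
theorem srt_of_crossFree (k : ℕ) {l : List ℕ} (hl : l.Nodup) (h : CrossFree (k + 1) l) :
    Srt (6 * (k * k) + 10 * k + 8) l := by
  induction k generalizing l with
  | zero =>
    refine Srt.of_length_le_one _ ?_
    by_contra! hlt
    simpa using h [l] (by simp) (fun Y hY => List.mem_singleton.1 hY ▸ hlt) (by simp)
  | succ k ih =>
    have hkk : k ≤ k * k := Nat.le_mul_self k
    -- With `f` the bound for `k`, here `r = 4 + f + 4 * (k + 1)`; presorting and the final sort add
    -- `4 * (k + 1)` each. The constant 8 makes `f` large enough for the hypothesis `hf`, with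
    -- equality at `k = 0`.
    have hR := fun ZL m ZR => srt_of_context (k := k + 1) (by omega)
      (fun q hq hc => ih hq hc) (by nlinarith) (ZL := ZL) (m := m) (ZR := ZR)
    obtain ⟨Bs, hBs⟩ := exists_presorting (k := k + 1) (by nlinarith) hR hl h
      (γ := fun _ => 0) monotone_const (fun m _ hc => Srt.of_length_le_one _
        (length_le_one_of_chain hc fun _ _ _ _ => rfl))
    refine (Srt.of_steps hBs.steps (Srt.flatten hBs.srt hBs.lt)).mono (le_of_eq ?_)
    ring

theorem bound_le_three_pow (k : ℕ) : 6 * (k * k) + 10 * k + 8 ≤ 4 * 3 ^ (k + 1) := by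
  induction k with
  | zero => norm_num
  | succ k ih =>
    rw [pow_succ]
    nlinarith

/-! ### Translation between lists and permutations -/

/-- `τ` sends old positions to new ones. No permutation of the empty set is separable, so empty
summands are removed first. -/
theorem SepRel.exists_isSeparable {α : Type*} {l l' : List α} (h : SepRel l l') :
    ∀ n, l.length = n → n ≠ 0 → ∃ τ : Equiv.Perm (Fin n), IsSeparable τ ∧
      ∀ x : Fin n, l'[(τ x : ℕ)]? = l[(x : ℕ)]? := by
  induction h with
  | nil => intro n hn hn0; exact absurd hn.symm hn0
  | single a =>
    rintro n rfl -
    exact ⟨1, .one, fun x => rfl⟩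
  | @sum a a' b b' h₁ h₂ ih₁ ih₂ =>
    rintro n hn hn0
    have ea := h₁.perm.length_eq
    have eb := h₂.perm.length_eq
    by_cases ha : a = []
    · subst ha
      obtain rfl : a' = [] := h₁.perm.symm.eq_nil
      exact ih₂ n (by simpa using hn) hn0
    by_cases hb : b = []
    · subst hb
      obtain rfl : b' = [] := h₂.perm.symm.eq_nil
      simpa using ih₁ n (by simpa using hn) hn0
    obtain rfl : a.length + b.length = n := by simpa using hn
    obtain ⟨σ, hσ, hσ'⟩ := ih₁ _ rfl (by simpa using ha)
    obtain ⟨τ, hτ, hτ'⟩ := ih₂ _ rfl (by simpa using hb)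
    refine ⟨_, hσ.directSum hτ, fun x => ?_⟩
    refine Fin.addCases (fun i => ?_) (fun i => ?_) x
    · have hi := (σ i).isLt
      simpa [PermFactor.directSum, List.getElem?_append, ← ea, hi] using hσ' i
    · simpa [PermFactor.directSum, List.getElem?_append, ← ea] using hτ' i
  | @skew a a' b b' h₁ h₂ ih₁ ih₂ =>
    rintro n hn hn0
    have ea := h₁.perm.length_eq
    have eb := h₂.perm.length_eq
    by_cases ha : a = []
    · subst ha
      obtain rfl : a' = [] := h₁.perm.symm.eq_nil
      simpa using ih₂ n (by simpa using hn) hn0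
    by_cases hb : b = []
    · subst hb
      obtain rfl : b' = [] := h₂.perm.symm.eq_nil
      simpa using ih₁ n (by simpa using hn) hn0
    obtain rfl : a.length + b.length = n := by simpa using hn
    obtain ⟨σ, hσ, hσ'⟩ := ih₁ _ rfl (by simpa using ha)
    obtain ⟨τ, hτ, hτ'⟩ := ih₂ _ rfl (by simpa using hb)
    refine ⟨_, hσ.skewSum hτ, fun x => ?_⟩
    refine Fin.addCases (fun i => ?_) (fun i => ?_) x
    · simpa [PermFactor.skewSum, List.getElem?_append, ← eb] using hσ' i
    · have hi := (τ i).isLt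
      simpa [PermFactor.skewSum, List.getElem?_append, ← eb, hi] using hτ' i

theorem Steps.exists_prod {α : Type*} {m n : ℕ} {l l' : List α} (h : Steps m l l')
    (hl : l.length = n) (hn : n ≠ 0) :
    ∃ L : List (Equiv.Perm (Fin n)), L.length = m ∧ (∀ τ ∈ L, IsSeparable τ) ∧
      ∀ x : Fin n, l'[(L.prod x : ℕ)]? = l[(x : ℕ)]? := by
  induction m generalizing l with
  | zero =>
    cases h
    exact ⟨[], rfl, by simp, fun x => rfl⟩
  | succ m ih =>
    obtain ⟨l₁, h₁, h₂⟩ := h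
    obtain ⟨τ, hτ, hτ'⟩ := h₁.exists_isSeparable n hl hn
    obtain ⟨L, hL, hs, hL'⟩ := ih h₂ (h₁.perm.length_eq ▸ hl)
    -- Products act from the right, so the first rearrangement is the last factor.
    refine ⟨L ++ [τ], by simp [hL], ?_, fun x => ?_⟩
    · intro ρ hρ
      rcases List.mem_append.1 hρ with hρ | hρ
      · exact hs ρ hρ
      · exact List.mem_singleton.1 hρ ▸ hτ
    · rw [List.prod_append, List.prod_singleton, Equiv.Perm.mul_apply, hL', hτ']

/-- The sequence of values of a permutation. -/
def values {n : ℕ} (σ : Equiv.Perm (Fin n)) : List ℕ := List.ofFn fun x => (σ x : ℕ)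

theorem values_nodup {n : ℕ} (σ : Equiv.Perm (Fin n)) : (values σ).Nodup :=
  List.nodup_ofFn.2 (Fin.val_injective.comp σ.injective)

theorem exists_list_of_srt {m n : ℕ} (hn : n ≠ 0) {σ : Equiv.Perm (Fin n)}
    (h : Srt m (values σ)) :
    ∃ L : List (Equiv.Perm (Fin n)), L.length = m ∧ (∀ τ ∈ L, IsSeparable τ) ∧ L.prod = σ := by
  obtain ⟨l', hst, hs⟩ := h
  have e : l' = List.range n := by
    refine eq_of_perm_sorted ?_ hs List.pairwise_lt_range
    rw [List.perm_ext_iff_of_nodup (hst.perm.nodup_iff.1 (values_nodup σ)) List.nodup_range]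
    intro a
    rw [← hst.perm.mem_iff, values, List.mem_ofFn, List.mem_range]
    constructor
    · rintro ⟨x, rfl⟩
      exact (σ x).isLt
    · intro ha
      exact ⟨σ.symm ⟨a, ha⟩, by simp⟩
  subst e
  obtain ⟨L, hL, hsep, hL'⟩ := hst.exists_prod (n := n) (by simp [values]) hn
  refine ⟨L, hL, hsep, Equiv.ext fun x => Fin.ext ?_⟩
  simpa [values] using hL' x

/-- Crossing intervals of positions give an almost mixed minor. -/
theorem crossFree_of_almostMixedFree {k n : ℕ} (hk : 1 ≤ k) {σ : Equiv.Perm (Fin n)}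
    (h : AlmostMixedFree k σ) : CrossFree k (values σ) := by
  intro Ys hY h2 hcr
  by_contra! hlen
  apply h
  obtain ⟨Ws, hWm, hWl, hWne, hWc⟩ : ∃ Ws : List (List ℕ), Ws.flatten = values σ ∧
      Ws.length = k ∧ (∀ W ∈ Ws, W ≠ []) ∧ Ws.Pairwise Cross := by
    have hlk : (Ys.take k).length = k := by simpa using hlen
    obtain ⟨Ws, h₁, h₂⟩ := exists_expand (Ys := Ys.take k) (m := values σ)
      (by rw [← List.length_pos_iff]; omega)
      ((List.Sublist.flatten (List.take_sublist k Ys)).trans hY)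
    refine ⟨Ws, h₁, h₂.length_eq ▸ hlk, fun W hW => ?_,
      pairwise_cross_of_forall₂ h₂ (hcr.sublist (List.take_sublist k Ys))⟩
    obtain ⟨Y, hYm, hs⟩ := exists_of_forall₂_right h₂ hW
    have := (h2 Y (List.mem_of_mem_take hYm)).trans hs.length_le
    rintro rfl
    simp at this
  subst hWl
  have hmem : ∀ {a}, a ∈ Ws.flatten ↔ ∃ x, (σ x : ℕ) = a := by
    intro a
    rw [hWm, values, List.mem_ofFn]
  have hord : Ws.Pairwise fun A B => ∀ x y : Fin n, (σ x : ℕ) ∈ A → (σ y : ℕ) ∈ B → x < y := by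
    have : (values σ).Pairwise fun a b => ∀ x y : Fin n, (σ x : ℕ) = a → (σ y : ℕ) = b → x < y := by
      rw [values, List.pairwise_ofFn]
      intro i j hij x y hx hy
      obtain rfl := σ.injective (Fin.ext hx)
      obtain rfl := σ.injective (Fin.ext hy)
      exact hij
    rw [← hWm, List.pairwise_flatten] at this
    exact this.2.imp fun hAB x y hx hy => hAB _ hx _ hy x y rfl rfl
  let P : IntervalPartition n Ws.length :=
    { part := fun i => Finset.univ.filter fun x => (σ x : ℕ) ∈ Ws[i]
      nonempty := fun i => by
        obtain ⟨a, ha⟩ := List.exists_mem_of_ne_nil _ (hWne Ws[i] (List.getElem_mem _))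
        obtain ⟨x, hx⟩ := hmem.1 (List.mem_flatten.2 ⟨_, List.getElem_mem _, ha⟩)
        exact ⟨x, by simpa [hx] using ha⟩
      exists_mem := fun x => by
        obtain ⟨W, hW, hx⟩ := List.mem_flatten.1 (hmem.2 ⟨x, rfl⟩)
        obtain ⟨i, hi, rfl⟩ := List.getElem_of_mem hW
        exact ⟨⟨i, hi⟩, by simpa using hx⟩
      lt_of_lt := fun i j hij x hx y hy => by
        have := List.pairwise_iff_getElem.1 hord i j i.2 j.2 hij
        simp only [Finset.mem_filter, Finset.mem_univ, true_and] at hx hy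
        exact this x y hx hy }
  have hP : ∀ i x, x ∈ P.part i ↔ (σ x : ℕ) ∈ Ws[i] := fun i x => by simp [P]
  refine ⟨P, P, fun i j hij => ?_⟩
  have hc : Cross Ws[i] Ws[j] := by
    rcases lt_or_gt_of_ne hij with h | h
    · exact List.pairwise_iff_getElem.1 hWc i j i.2 j.2 h
    · exact (List.pairwise_iff_getElem.1 hWc j i j.2 i.2 h).symm
  have hget : ∀ (i : Fin Ws.length) {a}, a ∈ Ws[i] → ∃ x ∈ P.part i, (σ x : ℕ) = a := by
    intro i a ha
    obtain ⟨x, rfl⟩ := hmem.1 (List.mem_flatten.2 ⟨_, List.getElem_mem _, ha⟩)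
    exact ⟨x, (hP i x).2 ha, rfl⟩
  obtain ⟨⟨a, ha, b, hb, b', hb', hba, hab'⟩, c, hcm, d, hd, d', hd', hdc, hcd'⟩ := hc
  -- The same partition serves rows and columns. A value of part `i` strictly inside the hull of
  -- part `j` gives a non-constant row; the other half of the crossing gives a non-constant column.
  constructor
  · intro hh
    obtain ⟨x, hx, rfl⟩ := hget i ha
    obtain ⟨y, hy, rfl⟩ := hget j hb
    obtain ⟨y', hy', rfl⟩ := hget j hb'
    have := hh x hx y hy y' hy'
    have h₁ : ¬ σ x < σ y := not_lt.2 (Fin.le_iff_val_le_val.2 hba.le)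
    have h₂ : σ x < σ y' := hab'
    simp [adjMatrix, h₁, h₂] at this
  · intro hh
    obtain ⟨x, hx, rfl⟩ := hget j hcm
    obtain ⟨y, hy, rfl⟩ := hget i hd
    obtain ⟨y', hy', rfl⟩ := hget i hd'
    have := hh x hx y hy y' hy'
    have h₁ : σ y < σ x := hdc
    have h₂ : ¬ σ y' < σ x := not_lt.2 (Fin.le_iff_val_le_val.2 hcd'.le)
    simp [adjMatrix, h₁, h₂] at this

end PermFactor

theorem mainTheorem3 (k : ℕ) (hk : 1 ≤ k) (n : ℕ) (σ : Equiv.Perm (Fin n))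
    (hσ : PermFactor.AlmostMixedFree k σ) :
    ∃ l : List (Equiv.Perm (Fin n)),
      l.length ≤ 4 * 3 ^ k ∧ (∀ τ ∈ l, PermFactor.IsSeparable τ) ∧ l.prod = σ := by
  by_cases hn : n = 0
  · subst hn
    exact ⟨[], by simp, by simp, Subsingleton.elim _ _⟩
  obtain ⟨j, rfl⟩ := Nat.exists_eq_add_of_le' hk
  have hc := PermFactor.crossFree_of_almostMixedFree hk hσ
  obtain ⟨L, hL, hs, hp⟩ := PermFactor.exists_list_of_srt hn
    (PermFactor.srt_of_crossFree j (PermFactor.values_nodup σ) hc)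
  exact ⟨L, hL.trans_le (PermFactor.bound_le_three_pow j), hs, hp⟩
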